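/- Let $\lambda_+,\lambda_->0$ with $\lambda_++\lambda_-=1$ and let $p\in(0,1)$. Let $(\varOmega,\mathbf P)$ be a probability space supporting i.i.d. rate one Poisson processes $(N_x(t))_{t\ge 0}$, $x\in\mathbf Z$, and, independent of them, i.i.d. uniform $[0,1]$ variables $U_{x,j}$, $x\in\mathbf Z$, $j\in\mathbf N$. Let $\mathrm{Ber}_p$ be the product measure on $\Omega[\mathbf Z]=\{-1,1\}^{\mathbf Z}$ with $\mathrm{Ber}_p(\sigma(x)=1)=p$ for all $x$, and put $\mathbf P_{\mathrm{Ber}_p}=\mathrm{Ber}_p\times\mathbf P$ on $\Sigma=\Omega[\mathbf Z]\times\varOmega$. For $L\in\mathbf N$ and $(\sigma_0,\omega)\in\Sigma$ let $(\sigma^L_t)_{t\ge0}$ be the following process started from $\sigma^L_0=\sigma_0$. At each arrival time $s$ of $N_x$ with $x\ge -L$, let $z(x)$ be the first site to the right of $x$ with $\sigma^L_{s^-}(z(x))\ne\sigma^L_{s^-}(x)$. If $\sigma^L_{s^-}(x)=+1$, the spins at $x$ and $z(x)$ are exchanged if and only if $U_{x,N_x(s)}<\lambda_+$; if $\sigma^L_{s^-}(x)=-1$,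 they are exchanged if and only if $U_{x,N_x(s)}>\lambda_+$. Arrivals at sites $x<-L$ have no effect. (The spin $\sigma_t^L(x)$ depends only on $\sigma_0$ and on the arrivals at the sites of $[-L,x]$ up to time $t$, which are almost surely finitely many.) Then the almost sure limit $\sigma_{[0,t)}=\lim_{L\to\infty}\sigma^L_{[0,t)}$ exists for every $t\ge0$, and these limits are the restrictions of one process on $\mathbf Z$. Precisely, there is a measurable process $(\sigma_t)_{t\ge0}$ on $\Sigma$ with values in $\Omega[\mathbf Z]$ and càdlàg paths such that, for every $t\ge 0$, $\mathbf P_{\mathrm{Ber}_p}$-almost surely, the restrictions of $\sigma^L$ to $[0,t)$ are càdlàg and converge, as $L\to\infty$, to the restriction of $\sigma$ in the Skorokhod space $D[0,t)$ of $\Omega[\mathbf Z]$-valued càdlàg paths; moreover, for every $x\in\mathbf Z$, the paths $(\sigma^L_s(x))_{0\le s<t}$ and $(\sigma_s(x))_{0\le s<t}$ coincide for all sufficiently large $L$. -/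

import Mathlib

open MeasureTheory ProbabilityTheory Filter Topology
open scoped NNReal ENNReal

namespace ToomInterface

/-- Spin configurations on `ℤ`; `true` is the spin `+1` and `false` is the spin `-1`.
It carries the product topology, product uniformity and product `σ`-algebra. -/
abbrev Config : Type := ℤ → Bool

/-- The product Bernoulli measure with `σ(x) = +1` with probability `p` at every site. -/
noncomputable def ber (p : unitInterval) : Measure Config :=
  Measure.infinitePi (fun _ : ℤ => bernoulliMeasure true false p)

/-! ### The driving noise -/

/-- `N` is (a version of) a rate one Poisson process on `[0, ∞)` given by its counting paths. -/
structure IsPoissonProcess {Ω : Type*} [MeasurableSpace Ω] (N : ℝ≥0 → Ω → ℕ)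
    (P : Measure Ω) : Prop where
  measurable : ∀ t, Measurable (N t)
  zero : ∀ᵐ ω ∂P, N 0 ω = 0
  mono : ∀ᵐ ω ∂P, Monotone fun t => N t ω
  rightCont : ∀ᵐ ω ∂P, ∀ t, ContinuousWithinAt (fun s => N s ω) (Set.Ici t) t
  increments : ∀ s t, s ≤ t → P.map (fun ω => N t ω - N s ω) = poissonMeasure (t - s)
  indep : HasIndepIncrements N P

/-- The noise on the probability space `(Ω, P)`: i.i.d. rate one Poisson processes `N x`, `x ∈ ℤ`,
and, independent of them, i.i.d. uniform variables `U (x, j)` on `[0, 1]`. -/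
structure IsNoise {Ω : Type*} [MeasurableSpace Ω] (N : ℤ → ℝ≥0 → Ω → ℕ)
    (U : ℤ × ℕ → Ω → ℝ) (P : Measure Ω) : Prop where
  poisson : ∀ x, IsPoissonProcess (N x) P
  indep_N : iIndepFun (fun (x : ℤ) (ω : Ω) => fun t : ℝ≥0 => N x t ω) P
  measurable_U : ∀ i, Measurable (U i)
  uniform : ∀ i, pdf.IsUniform (U i) (Set.Icc 0 1) P volume
  indep_U : iIndepFun U P
  indep_N_U : IndepFun (fun (ω : Ω) => fun (x : ℤ) (t : ℝ≥0) => N x t ω)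
    (fun (ω : Ω) => fun i => U i ω) P

/-! ### The update rule -/

open Classical in
/-- Exchange the spin at `x` with the first spin to the right of `x` that is opposite to it
(the first opposite site is `x + 1 + k` for the least possible `k`). If there is no such spin,
nothing happens. -/
noncomputable def exchange (η : Config) (x : ℤ) : Config :=
  if h : ∃ k : ℕ, η (x + 1 + k) ≠ η x then
    η ∘ Equiv.swap x (x + 1 + (Nat.find h : ℕ))
  else η

open Classical in
/-- The update at an arrival at `x` whose uniform variable has the value `u`: a `+` spin is
exchanged iff `u < lam`, and a `-` spin is exchanged iff `u > lam`, where `lam` is the rate of the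
`+` spins. -/
noncomputable def update (lam : ℝ) (η : Config) (x : ℤ) (u : ℝ) : Config :=
  if (η x = true ∧ u < lam) ∨ (η x = false ∧ lam < u) then exchange η x else η

/-! ### The cut-off dynamics on `[-L, ∞)` -/

/-- `s` is an arrival time of the counting path `n`. -/
def IsArrival (n : ℝ≥0 → ℕ) (s : ℝ≥0) : Prop :=
  0 < s ∧ ∀ r < s, n r < n s

/-- The pairs (arrival time, site) with time in `[0, t]` and site in `[-L, R]`. -/
def arrivalSet (n : ℤ → ℝ≥0 → ℕ) (L : ℕ) (R : ℤ) (t : ℝ≥0) : Set (ℝ≥0 ×ₗ ℤ) :=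
  {q | (ofLex q).1 ≤ t ∧ -(L : ℤ) ≤ (ofLex q).2 ∧ (ofLex q).2 ≤ R ∧
    IsArrival (n (ofLex q).2) (ofLex q).1}

open Classical in
/-- The elements of `arrivalSet` in chronological order. (The set is almost surely finite, with
pairwise different times.) -/
noncomputable def arrivalList (n : ℤ → ℝ≥0 → ℕ) (L : ℕ) (R : ℤ) (t : ℝ≥0) : List (ℝ≥0 ×ₗ ℤ) :=
  if h : (arrivalSet n L R t).Finite then h.toFinset.sort (· ≤ ·) else []

/-- The configuration at time `t` when only the sites in the finite window `[-L, R]` are active: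
starting from `σ₀`, all arrivals in the window up to time `t` are carried out in chronological
order. The arrival at `x` at time `s` uses the uniform variable with index `(x, n x s)`. -/
noncomputable def windowState (lam : ℝ) (n : ℤ → ℝ≥0 → ℕ) (u : ℤ × ℕ → ℝ) (σ₀ : Config)
    (L : ℕ) (R : ℤ) (t : ℝ≥0) : Config :=
  (arrivalList n L R t).foldl
    (fun η q => update lam η (ofLex q).2 (u ((ofLex q).2, n (ofLex q).2 (ofLex q).1))) σ₀

/-- The cut-off process `σ^L`, in which the sites of `[-L, ∞)` are active and the sites `x < -L`
are frozen. An arrival at a site changes spins only at this site and to the right of it, so the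
spin at `x` is determined by the arrivals in the finite window `[-L, x]`. -/
noncomputable def cutoff (lam : ℝ) (n : ℤ → ℝ≥0 → ℕ) (u : ℤ × ℕ → ℝ) (σ₀ : Config)
    (L : ℕ) (t : ℝ≥0) : Config :=
  fun x => windowState lam n u σ₀ L x t x

/-! ### The path space `D[0, T)` -/

/-- The path `f` is right-continuous with left limits on `[0, T)`. -/
def IsCadlagOn {E : Type*} [TopologicalSpace E] (T : ℝ≥0) (f : ℝ≥0 → E) : Prop :=
  ∀ s < T, ContinuousWithinAt f (Set.Ici s) s ∧ ∃ l, Tendsto f (𝓝[<] s) (𝓝 l)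

/-- Convergence in the Skorokhod space `D[0, T)` of the restrictions to `[0, T)` of the paths
`F n` to that of `f`: there are time changes of `[0, T)` (increasing bijections) that converge to
the identity, and along which `F n` converges to `f`, uniformly on each `[0, S]` with `S < T`. -/
def TendstoSkorokhod {E : Type*} [UniformSpace E] (T : ℝ≥0) (F : ℕ → ℝ≥0 → E)
    (f : ℝ≥0 → E) : Prop :=
  (∀ n, IsCadlagOn T (F n)) ∧ IsCadlagOn T f ∧
    ∃ θ : ℕ → (Set.Iio T ≃o Set.Iio T), ∀ S : Set.Iio T,
      TendstoUniformlyOn (fun n s => ((θ n s : Set.Iio T) : ℝ≥0)) (fun s => (s : ℝ≥0))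
        atTop (Set.Iic S) ∧
      TendstoUniformlyOn (fun n s => F n ((θ n s : Set.Iio T) : ℝ≥0)) (fun s => f (s : ℝ≥0))
        atTop (Set.Iic S)

end ToomInterface

/-!
The cut-off dynamics `σ^L` and `σ^(L+1)` differ only through the arrivals at the site `-(L+1)`. It is
shown that with overwhelming probability the resulting discrepancies do not reach a fixed site `x`
before a fixed time `T` if `L` is large; the Borel-Cantelli lemma then gives that the paths of `σ^L`
at `x` are eventually constant in `L`, and the limit process is read off from these constant values.

*Domination by the Bernoulli measure.* The half-line dynamics does not preserve the Bernoulli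
measure, but it does so up to a bounded factor. In a window with `v` sites, a configuration has, for
each site, one preimage of the same weight under the attempts of a spin `s` at all sites to move,
plus at most one preimage in which a spin `s` leaves the window to the right, and this preimage has
at most `c` times its weight (`sum_wt_hop_le`). Hence, with arrivals at total rate `v`, the density
of the dynamics with respect to the Bernoulli measure is at most `exp (c T)` up to time `T`, for all
cut-offs. The same computation, summed over the arrivals, bounds the probability that the dynamics
ever has `K + 1` consecutive equal spins in the window by a polynomial in `v` times `r ^ K`, where
`r < 1` (`IsNoise.measure_exists_hasRun_le`). Arrivals are handled by a grid of cells so short that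
no cell contains two arrivals, except on an event whose probability vanishes with the mesh: what
happens during the cells is then a finite word, the probability of which is a product
(`IsNoise.measure_wordEvent`).

*Blocking.* Without runs of `K + 1` equal spins, an exchange reaches at most `K` sites to the right.
Thus during a time interval without arrivals in a strip of `K` sites, nothing to the left of the
strip influences what is to the right of it. The time interval `[0, T]` is divided into intervals of
length `1 / K`, and to the `i`-th interval a region of `K` strips is assigned, further to the right
for larger `i`. In a given interval, all strips of the region have arrivals with probability
`(1 - exp (-1)) ^ K` only, so it is likely that a discrepancy is stopped in each interval, and that
it has not left the region of length `T K ^ 3` at time `T` (`agree_of_strips`,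
`IsNoise.measure_windowState_ne_le`).

*Regularity.* The counting paths are locally constant on both sides of each time, which makes the
cut-off and the limit paths càdlàg, and the coincidence of the coordinates gives the convergence in
the Skorokhod space with trivial time changes. The limit is measurable because the state at a fixed
time is a limit along dyadic grids of explicit functions of the increments
(`eventually_gridState_eq_cutoff`).
-/

namespace ToomInterface

/-! ### The exchange dynamics on a finite window -/

/-- `∑ [P i] ≤ 1` if at most one index satisfies `P`. -/
lemma sum_ite_le_one {ι : Type*} [Fintype ι] {P : ι → Prop} [DecidablePred P] (h : ∀ i j, P i → P j → i = j) :
    (∑ i, if P i then (1 : ℝ≥0∞) else 0) ≤ 1 := by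
  rw [Finset.sum_boole]
  have : (Finset.univ.filter P).card ≤ 1 :=
    Finset.card_le_one.2 fun a ha b hb => h a b (by simpa using ha) (by simpa using hb)
  exact_mod_cast this

section Window

variable {ι : Type*} [LinearOrder ι]

/-- `j` is the first site to the right of `i` whose spin is opposite to the spin at `i`. -/
def FirstOpp (η : ι → Bool) (i j : ι) : Prop :=
  i < j ∧ η j ≠ η i ∧ ∀ k, i < k → k < j → η k = η i

lemma FirstOpp.unique {η : ι → Bool} {i j k : ι} (hj : FirstOpp η i j) (hk : FirstOpp η i k) :
    j = k := by
  rcases lt_trichotomy j k with h | h | h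
  · exact absurd (hk.2.2 j hj.1 h) hj.2.1
  · exact h
  · exact absurd (hj.2.2 k hk.1 h) hk.2.1

variable [Fintype ι]

open Classical in
/-- The attempt of a spin `s` at site `i` of a finite window to move: it is exchanged with the first
opposite spin to its right, and if the window contains no such spin, then it leaves the window and
is replaced by a spin `!s`. If the spin at `i` is not `s`, nothing happens. -/
noncomputable def hop (s : Bool) (i : ι) (η : ι → Bool) : ι → Bool :=
  if η i ≠ s then η
  else if h : ∃ j, FirstOpp η i j then η ∘ Equiv.swap i h.choose
  else Function.update η i (!s)

/-- The weight of a window configuration under the product measure with single-site weights `q`. -/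
noncomputable def wt (q : Bool → ℝ≥0∞) (η : ι → Bool) : ℝ≥0∞ := ∏ i, q (η i)

lemma exists_firstOpp {η : ι → Bool} {i j : ι} (hij : i < j) (hne : η j ≠ η i) :
    ∃ k, FirstOpp η i k := by
  obtain ⟨k, ⟨hk1, hk2⟩, hk3⟩ :=
    (wellFounded_lt (α := ι)).has_min {k | i < k ∧ η k ≠ η i} ⟨j, hij, hne⟩
  exact ⟨k, hk1, hk2, fun l hl hlk => by_contra fun hc => hk3 l ⟨hl, hc⟩ hlk⟩

lemma hop_of_ne {s : Bool} {i : ι} {η : ι → Bool} (h : η i ≠ s) : hop s i η = η := by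
  simp [hop, h]

lemma hop_of_firstOpp {s : Bool} {i j : ι} {η : ι → Bool} (h : η i = s) (hj : FirstOpp η i j) :
    hop s i η = η ∘ Equiv.swap i j := by
  have hex : ∃ j, FirstOpp η i j := ⟨j, hj⟩
  rw [hop, if_neg (by simp [h]), dif_pos hex, hex.choose_spec.unique hj]

lemma hop_of_forall {s : Bool} {i : ι} {η : ι → Bool} (h : η i = s) (hj : ∀ j, i < j → η j = s) :
    hop s i η = Function.update η i (!s) := by
  rw [hop, if_neg (by simp [h]), dif_neg]
  rintro ⟨j, h1, h2, -⟩
  exact h2 (by rw [hj j h1, h])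

lemma wt_comp_swap (q : Bool → ℝ≥0∞) (η : ι → Bool) (i j : ι) :
    wt q (η ∘ Equiv.swap i j) = wt q η :=
  Equiv.prod_comp (Equiv.swap i j) fun k => q (η k)

lemma wt_flip_le (q : Bool → ℝ≥0∞) {c : ℝ≥0∞} {s : Bool} (hc : q s ≤ c * q (!s)) (η : ι → Bool)
    {i : ι} (hi : η i ≠ s) : wt q (Function.update η i (!η i)) ≤ c * wt q η := by
  have hi' : η i = !s := by revert hi; cases η i <;> cases s <;> simp
  rw [wt, wt, ← Finset.mul_prod_erase _ _ (Finset.mem_univ i),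
    ← Finset.mul_prod_erase Finset.univ (fun k => q (η k)) (Finset.mem_univ i), ← mul_assoc]
  refine mul_le_mul' (by simpa [hi'] using hc) (le_of_eq (Finset.prod_congr rfl fun k hk => ?_))
  rw [Function.update_of_ne (Finset.ne_of_mem_erase hk)]

open Classical in
lemma hop_term_le (q : Bool → ℝ≥0∞) (s : Bool) (g : (ι → Bool) → ℝ≥0∞) (i : ι) (η : ι → Bool) :
    wt q η * g (hop s i η) ≤
      ((if η i ≠ s then wt q η * g η else 0) +
        ∑ j, if η i = s ∧ FirstOpp η i j then
          wt q (η ∘ Equiv.swap i j) * g (η ∘ Equiv.swap i j) else 0) +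
      (if η i = s ∧ ∀ j, i < j → η j = s then
          wt q η * g (Function.update η i (!η i)) else 0) := by
  by_cases h : η i = s
  · by_cases hall : ∀ j, i < j → η j = s
    · rw [hop_of_forall h hall, if_pos (⟨h, hall⟩ : _ ∧ _), h]
      exact le_add_self
    · push Not at hall
      obtain ⟨j, hij, hj⟩ := hall
      obtain ⟨k, hk⟩ := exists_firstOpp hij (h.symm ▸ hj)
      refine le_add_right (le_add_left ?_)
      refine le_trans ?_ (Finset.single_le_sum (fun _ _ => zero_le) (Finset.mem_univ k))
      rw [if_pos ⟨h, hk⟩, hop_of_firstOpp h hk, wt_comp_swap]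
  · rw [hop_of_ne h, if_pos h]
    exact le_add_right le_self_add

/-- Summed over all sites, the attempts of the spins `s` to move preserve the product measure up to
the factor `card ι + c`: a configuration `η` is the image of `η` itself for each site with spin `!s`
and of one exchanged configuration (of the same weight) for each site with spin `s`; in addition
it arises from at most one configuration by a spin leaving the window. -/
theorem sum_wt_hop_le (q : Bool → ℝ≥0∞) {c : ℝ≥0∞} {s : Bool} (hc : q s ≤ c * q (!s))
    (g : (ι → Bool) → ℝ≥0∞) :
    ∑ i, ∑ η, wt q η * g (hop s i η) ≤ (Fintype.card ι + c) * ∑ η, wt q η * g η := by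
  classical
  have swapInv : ∀ i j : ι, Function.Involutive fun η : ι → Bool => η ∘ Equiv.swap i j := by
    intro i j η
    funext k
    simp
  have flipInv : ∀ i : ι,
      Function.Involutive fun η : ι → Bool => Function.update η i (!η i) := by
    intro i η
    simp
  -- a move `i → j` that stays in the window is undone by exchanging `i` and `j` once more
  have hswap : ∀ i j : ι,
      (∑ η : ι → Bool, if η i = s ∧ FirstOpp η i j then
          wt q (η ∘ Equiv.swap i j) * g (η ∘ Equiv.swap i j) else 0) =
        ∑ η : ι → Bool, if η j = s ∧ i < j ∧ η i ≠ s ∧ ∀ k, i < k → k < j → η k = s then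
          wt q η * g η else 0 := by
    intro i j
    rw [← Equiv.sum_comp ((swapInv i j).toPerm _)]
    refine Finset.sum_congr rfl fun η _ => ?_
    have e : (η ∘ Equiv.swap i j) ∘ Equiv.swap i j = η := swapInv i j η
    simp only [Function.Involutive.coe_toPerm, e]
    refine if_congr ?_ rfl rfl
    simp only [FirstOpp, Function.comp_apply, Equiv.swap_apply_left, Equiv.swap_apply_right]
    constructor
    · rintro ⟨h1, h2, h3, h4⟩
      refine ⟨h1, h2, h1 ▸ h3, fun k hk hk' => ?_⟩
      have := h4 k hk hk'
      rwa [Equiv.swap_apply_of_ne_of_ne hk.ne' hk'.ne, h1] at this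
    · rintro ⟨h1, h2, h3, h4⟩
      refine ⟨h1, h2, h1.symm ▸ h3, fun k hk hk' => ?_⟩
      rw [Equiv.swap_apply_of_ne_of_ne hk.ne' hk'.ne, h1, h4 k hk hk']
  -- a spin leaving the window flips its site, which costs the factor `c`
  have hflip : ∀ i : ι,
      (∑ η : ι → Bool, if η i = s ∧ ∀ j, i < j → η j = s then
          wt q η * g (Function.update η i (!η i)) else 0) ≤
        ∑ η : ι → Bool, if η i ≠ s ∧ ∀ j, i < j → η j = s then c * (wt q η * g η) else 0 := by
    intro i
    rw [← Equiv.sum_comp ((flipInv i).toPerm _)]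
    refine Finset.sum_le_sum fun η _ => ?_
    have e : Function.update (Function.update η i (!η i)) i (!Function.update η i (!η i) i) = η :=
      flipInv i η
    simp only [Function.Involutive.coe_toPerm, e]
    by_cases h : η i ≠ s ∧ ∀ j, i < j → η j = s
    · rw [if_pos h]
      split_ifs
      · rw [← mul_assoc]
        exact mul_le_mul' (wt_flip_le q hc η h.1) le_rfl
      · exact zero_le
    · rw [if_neg h, if_neg]
      rintro ⟨h1, h2⟩
      refine h ⟨?_, fun j hj => ?_⟩
      · rw [Function.update_self] at h1
        rw [← h1]
        cases η i <;> simp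
      · have := h2 j hj
        rwa [Function.update_of_ne hj.ne'] at this
  have hpt : ∀ η : ι → Bool,
      (∑ i, ((if η i ≠ s then wt q η * g η else 0) +
        ∑ j, if η j = s ∧ i < j ∧ η i ≠ s ∧ ∀ k, i < k → k < j → η k = s then
          wt q η * g η else 0)) +
      ∑ i, (if η i ≠ s ∧ ∀ j, i < j → η j = s then c * (wt q η * g η) else 0) ≤
        (Fintype.card ι + c) * (wt q η * g η) := by
    intro η
    rw [add_mul]
    refine add_le_add ?_ ?_
    · rw [Finset.sum_add_distrib, Finset.sum_comm (s := Finset.univ) (t := Finset.univ),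
        ← Finset.sum_add_distrib]
      -- each `j` is charged once: by `η` itself, or by the nearest spin `!s` to the left of `j`
      have : ∀ j, ((if η j ≠ s then wt q η * g η else 0) +
          ∑ i, if η j = s ∧ i < j ∧ η i ≠ s ∧ ∀ k, i < k → k < j → η k = s then
            wt q η * g η else 0) ≤ wt q η * g η := by
        intro j
        by_cases hj : η j = s
        · rw [if_neg (by simp [hj]), zero_add]
          have h1 : (∑ i, if η j = s ∧ i < j ∧ η i ≠ s ∧ ∀ k, i < k → k < j → η k = s then
              (1 : ℝ≥0∞) else 0) ≤ 1 := by
            refine sum_ite_le_one ?_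
            rintro a b ⟨-, a1, a2, a3⟩ ⟨-, b1, b2, b3⟩
            rcases lt_trichotomy a b with h | h | h
            · exact absurd (a3 b h b1) b2
            · exact h
            · exact absurd (b3 a h a1) a2
          calc _ = (∑ i, if η j = s ∧ i < j ∧ η i ≠ s ∧ ∀ k, i < k → k < j → η k = s then
              (1 : ℝ≥0∞) else 0) * (wt q η * g η) := by
                rw [Finset.sum_mul]
                exact Finset.sum_congr rfl fun i _ => by split_ifs <;> simp
            _ ≤ 1 * (wt q η * g η) := mul_le_mul' h1 le_rfl
            _ = _ := one_mul _
        · simp [hj]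
      calc _ ≤ ∑ _j : ι, wt q η * g η := Finset.sum_le_sum fun j _ => this j
        _ = _ := by simp
    -- only the rightmost spin `!s` can be where a spin `s` has left the window
    · have h1 : (∑ i, if η i ≠ s ∧ ∀ j, i < j → η j = s then (1 : ℝ≥0∞) else 0) ≤ 1 := by
        refine sum_ite_le_one ?_
        rintro a b ⟨a2, a3⟩ ⟨b2, b3⟩
        rcases lt_trichotomy a b with h | h | h
        · exact absurd (a3 b h) b2
        · exact h
        · exact absurd (b3 a h) a2
      calc _ = (∑ i, if η i ≠ s ∧ ∀ j, i < j → η j = s then (1 : ℝ≥0∞) else 0) *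
              (c * (wt q η * g η)) := by
            rw [Finset.sum_mul]
            exact Finset.sum_congr rfl fun i _ => by split_ifs <;> simp
        _ ≤ 1 * (c * (wt q η * g η)) := mul_le_mul' h1 le_rfl
        _ = _ := one_mul _
  calc ∑ i, ∑ η, wt q η * g (hop s i η)
      ≤ ∑ i, ∑ η : ι → Bool, (((if η i ≠ s then wt q η * g η else 0) +
        ∑ j, if η i = s ∧ FirstOpp η i j then
          wt q (η ∘ Equiv.swap i j) * g (η ∘ Equiv.swap i j) else 0) +
      (if η i = s ∧ ∀ j, i < j → η j = s then
          wt q η * g (Function.update η i (!η i)) else 0)) :=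
        Finset.sum_le_sum fun i _ => Finset.sum_le_sum fun η _ => hop_term_le q s g i η
    _ ≤ ∑ i, ∑ η : ι → Bool, (((if η i ≠ s then wt q η * g η else 0) +
        ∑ j, if η j = s ∧ i < j ∧ η i ≠ s ∧ ∀ k, i < k → k < j → η k = s then
          wt q η * g η else 0) +
        if η i ≠ s ∧ ∀ j, i < j → η j = s then c * (wt q η * g η) else 0) := by
        refine Finset.sum_le_sum fun i _ => ?_
        simp only [Finset.sum_add_distrib]
        refine add_le_add (add_le_add le_rfl ?_) (hflip i)
        rw [Finset.sum_comm, Finset.sum_comm (s := (Finset.univ : Finset (ι → Bool)))]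
        exact Finset.sum_le_sum fun j _ => (hswap i j).le
    _ = ∑ η : ι → Bool, ((∑ i, ((if η i ≠ s then wt q η * g η else 0) +
        ∑ j, if η j = s ∧ i < j ∧ η i ≠ s ∧ ∀ k, i < k → k < j → η k = s then
          wt q η * g η else 0)) +
        ∑ i, (if η i ≠ s ∧ ∀ j, i < j → η j = s then c * (wt q η * g η) else 0)) := by
        rw [Finset.sum_comm]
        exact Finset.sum_congr rfl fun η _ => Finset.sum_add_distrib
    _ ≤ ∑ η : ι → Bool, (Fintype.card ι + c) * (wt q η * g η) :=
        Finset.sum_le_sum fun η _ => hpt η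
    _ = _ := by rw [Finset.mul_sum]

end Window

section Words

variable {ι : Type*} [LinearOrder ι] [Fintype ι]

/-- The effect of a short time interval on a window configuration: `none` stands for an interval
without arrivals, and `some (i, s)` for a single arrival at `i` that permits a spin `s` to move. -/
noncomputable def act : Option (ι × Bool) → (ι → Bool) → ι → Bool
  | none, η => η
  | some (i, s), η => hop s i η

/-- The weight of a letter: `1` for no arrival, and `d * l s` for an arrival permitting `s`. -/
noncomputable def letterWt (d : ℝ≥0∞) (l : Bool → ℝ≥0∞) : Option (ι × Bool) → ℝ≥0∞
  | none => 1
  | some (_, s) => d * l s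

/-- The trajectory of `η` along a word of letters is in `A` immediately after some arrival. -/
def Hits (A : Set (ι → Bool)) : List (Option (ι × Bool)) → (ι → Bool) → Prop
  | [], _ => False
  | a :: w, η => (a ≠ none ∧ act a η ∈ A) ∨ Hits A w (act a η)

lemma mem_or_hits (A : Set (ι → Bool)) {m : ℕ} (w : Fin m → Option (ι × Bool))
    (st : ℕ → ι → Bool) (hst : ∀ k : Fin m, st (k + 1) = act (w k) (st k))
    {k : ℕ} (hk : k ≤ m) (hA : st k ∈ A) : st 0 ∈ A ∨ Hits A (List.ofFn w) (st 0) := by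
  induction m generalizing st k with
  | zero =>
    obtain rfl : k = 0 := by omega
    exact Or.inl hA
  | succ m ih =>
    cases k with
    | zero => exact Or.inl hA
    | succ k =>
      have h0 : st 1 = act (w 0) (st 0) := hst 0
      have := ih (fun i => w i.succ) (fun j => st (j + 1))
        (fun j => by simpa using hst j.succ) (Nat.le_of_succ_le_succ hk) hA
      rw [List.ofFn_succ]
      simp only [zero_add] at this
      rcases this with h | h
      · by_cases hw : w 0 = none
        · left
          rw [h0, hw] at h
          exact h
        · exact Or.inr (Or.inl ⟨hw, h0 ▸ h⟩)
      · exact Or.inr (Or.inr (h0 ▸ h))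

lemma sum_letterWt {ι : Type*} [Fintype ι] (d : ℝ≥0∞) {l : Bool → ℝ≥0∞} (hl : l true + l false = 1) :
    ∑ a : Option (ι × Bool), letterWt d l a = 1 + d * Fintype.card ι := by
  rw [Fintype.sum_option, Fintype.sum_prod_type]
  simp only [letterWt, Fintype.sum_bool, ← mul_add, hl, mul_one, Finset.sum_const, nsmul_eq_mul,
    Finset.card_univ]
  rw [mul_comm]

lemma sum_word_cons {α : Type*} [Fintype α] {M : Type*} [AddCommMonoid M] (k : ℕ)
    (F : (Fin (k + 1) → α) → M) :
    ∑ w, F w = ∑ a, ∑ w : Fin k → α, F (Fin.cons a w) := by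
  rw [← (Fin.consEquiv fun _ : Fin (k + 1) => α).sum_comp, Fintype.sum_prod_type]
  rfl

/-- The one-step estimate summed over all arrivals in a cell. -/
lemma sum_wt_act_le {q : Bool → ℝ≥0∞} {c d : ℝ≥0∞} {l : Bool → ℝ≥0∞}
    (hc : ∀ s, q s ≤ c * q (!s)) (hl : l true + l false = 1) (g : (ι → Bool) → ℝ≥0∞) :
    ∑ i : ι, ∑ s, d * l s * ∑ η, wt q η * g (hop s i η) ≤
      d * (Fintype.card ι + c) * ∑ η, wt q η * g η := by
  rw [Finset.sum_comm]
  simp only [← Finset.mul_sum]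
  calc ∑ s, d * l s * ∑ i, ∑ η, wt q η * g (hop s i η)
      ≤ ∑ s, d * l s * ((Fintype.card ι + c) * ∑ η, wt q η * g η) :=
        Finset.sum_le_sum fun s _ => mul_le_mul' le_rfl (sum_wt_hop_le q (hc s) g)
    _ = d * (l true + l false) * ((Fintype.card ι + c) * ∑ η, wt q η * g η) := by
        rw [Fintype.sum_bool]; ring
    _ = _ := by rw [hl]; ring

open Classical in
/-- The total weight of the words along which a Bernoulli configuration hits `A`. -/
theorem sum_wt_hits_le {q : Bool → ℝ≥0∞} {c d : ℝ≥0∞} {l : Bool → ℝ≥0∞}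
    (hc : ∀ s, q s ≤ c * q (!s)) (hl : l true + l false = 1) (A : Set (ι → Bool)) (k : ℕ) :
    ∑ η : ι → Bool, wt q η * ∑ w : Fin k → Option (ι × Bool),
        (if Hits A (List.ofFn w) η then ∏ i, letterWt d l (w i) else 0) ≤
      k * (d * (Fintype.card ι + c)) * (1 + d * (Fintype.card ι + c)) ^ k *
        ∑ η, wt q η * (if η ∈ A then 1 else 0) := by
  induction k with
  | zero => simp [Hits]
  | succ k ih =>
    set a := d * (Fintype.card ι + c) with ha
    set S := ∑ η : ι → Bool, wt q η * (if η ∈ A then 1 else 0) with hS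
    set h : (ι → Bool) → ℝ≥0∞ := fun η => ∑ w : Fin k → Option (ι × Bool),
        (if Hits A (List.ofFn w) η then ∏ i, letterWt d l (w i) else 0) with hh
    have htot : ∑ w : Fin k → Option (ι × Bool), ∏ i, letterWt d l (w i) ≤ (1 + a) ^ k := by
      rw [← Fintype.sum_pow, sum_letterWt d hl]
      gcongr
      rw [ha]
      gcongr
      exact le_self_add
    -- decomposition with respect to the first letter
    have hrec : ∀ η : ι → Bool, (∑ w : Fin (k + 1) → Option (ι × Bool),
        (if Hits A (List.ofFn w) η then ∏ i, letterWt d l (w i) else 0)) ≤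
        h η + ∑ i : ι, ∑ s, d * l s * ((if hop s i η ∈ A then 1 else 0) * (1 + a) ^ k +
          h (hop s i η)) := by
      intro η
      rw [sum_word_cons, Fintype.sum_option, Fintype.sum_prod_type]
      refine add_le_add (le_of_eq ?_) ?_
      · refine Finset.sum_congr rfl fun w _ => ?_
        simp [List.ofFn_succ, Hits, Fin.prod_univ_succ, letterWt, act]
      · refine Finset.sum_le_sum fun i _ => Finset.sum_le_sum fun s _ => ?_
        calc _ ≤ ∑ w : Fin k → Option (ι × Bool), d * l s *
              ((if hop s i η ∈ A then 1 else 0) * ∏ i, letterWt d l (w i) +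
              if Hits A (List.ofFn w) (hop s i η) then ∏ i, letterWt d l (w i) else 0) := by
              refine Finset.sum_le_sum fun w _ => ?_
              simp only [List.ofFn_succ, Hits, Fin.prod_univ_succ, Fin.cons_zero, Fin.cons_succ,
                letterWt, act, ne_eq, reduceCtorEq, not_false_eq_true, true_and]
              by_cases h1 : hop s i η ∈ A <;>
                by_cases h2 : Hits A (List.ofFn w) (hop s i η) <;> simp [h1, h2, mul_add]
          _ ≤ _ := by
              rw [← Finset.mul_sum, Finset.sum_add_distrib, ← Finset.mul_sum]
              gcongr
    calc _ ≤ ∑ η : ι → Bool, wt q η * (h η + ∑ i : ι, ∑ s, d * l s *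
          ((if hop s i η ∈ A then 1 else 0) * (1 + a) ^ k + h (hop s i η))) :=
          Finset.sum_le_sum fun η _ => mul_le_mul' le_rfl (hrec η)
      _ = ∑ η, wt q η * h η + ∑ i : ι, ∑ s, d * l s * ∑ η, wt q η *
          (fun ζ => (if ζ ∈ A then 1 else 0) * (1 + a) ^ k + h ζ) (hop s i η) := by
          simp only [mul_add (wt q _) (h _), Finset.sum_add_distrib]
          congr 1
          simp only [Finset.mul_sum]
          rw [Finset.sum_comm]
          refine Finset.sum_congr rfl fun i _ => ?_
          rw [Finset.sum_comm]
          refine Finset.sum_congr rfl fun s _ => Finset.sum_congr rfl fun η _ => ?_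
          ring
      _ ≤ ∑ η, wt q η * h η + a * ∑ η, wt q η *
          ((if η ∈ A then 1 else 0) * (1 + a) ^ k + h η) := by
          gcongr
          exact sum_wt_act_le hc hl fun ζ => (if ζ ∈ A then 1 else 0) * (1 + a) ^ k + h ζ
      _ = (1 + a) * ∑ η, wt q η * h η + a * (1 + a) ^ k * S := by
          simp only [mul_add (wt q _), Finset.sum_add_distrib, ← mul_assoc (wt q _)]
          rw [← Finset.sum_mul]
          ring
      _ ≤ (1 + a) * (k * a * (1 + a) ^ k * S) + (1 + a) * (a * (1 + a) ^ k * S) :=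
          add_le_add (mul_le_mul' le_rfl ih) (by
            conv_lhs => rw [← one_mul (a * (1 + a) ^ k * S)]
            exact mul_le_mul' le_self_add le_rfl)
      _ = _ := by push_cast; ring

open Classical in
/-- The total weight of the words along which a Bernoulli configuration is in `A` at some time. -/
theorem sum_wt_mem_or_hits_le {q : Bool → ℝ≥0∞} {c d : ℝ≥0∞} {l : Bool → ℝ≥0∞}
    (hc : ∀ s, q s ≤ c * q (!s)) (hl : l true + l false = 1) (A : Set (ι → Bool)) (k : ℕ) :
    ∑ η : ι → Bool, ∑ w : Fin k → Option (ι × Bool),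
        (if η ∈ A ∨ Hits A (List.ofFn w) η then wt q η * ∏ i, letterWt d l (w i) else 0) ≤
      (1 + k * (d * (Fintype.card ι + c))) * (1 + d * (Fintype.card ι + c)) ^ k *
        ∑ η, wt q η * (if η ∈ A then 1 else 0) := by
  have htot : ∑ w : Fin k → Option (ι × Bool), ∏ i, letterWt d l (w i) ≤
      (1 + d * (Fintype.card ι + c)) ^ k := by
    rw [← Fintype.sum_pow, sum_letterWt d hl]
    gcongr
    exact le_self_add
  calc _ ≤ ∑ η : ι → Bool, (wt q η * (if η ∈ A then 1 else 0) *
          (1 + d * (Fintype.card ι + c)) ^ k +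
        wt q η * ∑ w : Fin k → Option (ι × Bool),
        (if Hits A (List.ofFn w) η then ∏ i, letterWt d l (w i) else 0)) := by
        refine Finset.sum_le_sum fun η _ => ?_
        refine le_trans ?_ (add_le_add (mul_le_mul' le_rfl htot) le_rfl)
        rw [Finset.mul_sum, Finset.mul_sum, ← Finset.sum_add_distrib]
        refine Finset.sum_le_sum fun w _ => ?_
        by_cases h1 : η ∈ A <;> by_cases h2 : Hits A (List.ofFn w) η <;> simp [h1, h2]
    _ ≤ (1 + d * (Fintype.card ι + c)) ^ k * (∑ η, wt q η * (if η ∈ A then 1 else 0)) +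
        k * (d * (Fintype.card ι + c)) * (1 + d * (Fintype.card ι + c)) ^ k *
        ∑ η, wt q η * (if η ∈ A then 1 else 0) := by
        rw [Finset.sum_add_distrib, ← Finset.sum_mul, mul_comm]
        exact add_le_add le_rfl (sum_wt_hits_le hc hl A k)
    _ = _ := by ring

open Classical in
/-- The product weight of the configurations that are constant equal to `s` on `B`. -/
lemma sum_wt_const {q : Bool → ℝ≥0∞} (hq : q true + q false = 1) (B : Finset ι) (s : Bool) :
    ∑ η : ι → Bool, wt q η * (if ∀ i ∈ B, η i = s then 1 else 0) = q s ^ B.card := by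
  have h : ∀ η : ι → Bool, wt q η * (if ∀ i ∈ B, η i = s then (1 : ℝ≥0∞) else 0) =
      ∏ i, (if i ∈ B → η i = s then q (η i) else 0) := by
    intro η
    by_cases hB : ∀ i ∈ B, η i = s
    · rw [if_pos hB, mul_one]
      exact Finset.prod_congr rfl fun i _ => by rw [if_pos (hB i)]
    · rw [if_neg hB, mul_zero]
      push Not at hB
      obtain ⟨i, hi, hi'⟩ := hB
      refine (Finset.prod_eq_zero (Finset.mem_univ i) ?_).symm
      rw [if_neg fun hc => hi' (hc hi)]
  simp_rw [h]
  have h2 := (Fintype.prod_sum (κ := fun _ : ι => Bool)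
    fun i b => if i ∈ B → b = s then q b else 0).symm
  rw [h2]
  have h3 : ∀ i, (∑ b : Bool, if i ∈ B → b = s then q b else 0) = if i ∈ B then q s else 1 := by
    intro i
    by_cases hi : i ∈ B
    · cases s <;> simp [hi]
    · simp [hi, hq]
  simp_rw [h3]
  rw [Finset.prod_ite_mem]
  simp

end Words

/-! ### The update rule on `ℤ` -/

/-- Both spins occur arbitrarily far to the right. -/
def Rich (η : Config) : Prop := ∀ (s : Bool) (y : ℤ), ∃ z, y < z ∧ η z = s

/-- The value `u` of a uniform variable permits the spin `s` to move. -/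
def Permits (lam : ℝ) (s : Bool) (u : ℝ) : Prop := if s = true then u < lam else lam < u

lemma firstOpp_find {η : Config} {x : ℤ} [DecidablePred fun k : ℕ => η (x + 1 + k) ≠ η x]
    (h : ∃ k : ℕ, η (x + 1 + k) ≠ η x) : FirstOpp η x (x + 1 + (Nat.find h : ℕ)) := by
  refine ⟨by omega, Nat.find_spec h, fun k hk hk' => ?_⟩
  have := Nat.find_min h (m := (k - (x + 1)).toNat) (by omega)
  rw [not_not] at this
  rwa [show x + 1 + (((k - (x + 1)).toNat : ℕ) : ℤ) = k by omega] at this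

lemma exists_nat_of_lt {η : Config} {x z : ℤ} (hxz : x < z) (hne : η z ≠ η x) :
    ∃ k : ℕ, η (x + 1 + k) ≠ η x :=
  ⟨(z - (x + 1)).toNat, by rwa [show x + 1 + (((z - (x + 1)).toNat : ℕ) : ℤ) = z by omega]⟩

lemma exists_firstOpp_int {η : Config} {x z : ℤ} (hxz : x < z) (hne : η z ≠ η x) :
    ∃ y, FirstOpp η x y ∧ y ≤ z := by
  classical
  have h := firstOpp_find (exists_nat_of_lt hxz hne)
  refine ⟨_, h, ?_⟩
  by_contra hc
  exact hne (h.2.2 z hxz (not_le.1 hc))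

lemma exchange_of_firstOpp {η : Config} {x z : ℤ} (h : FirstOpp η x z) :
    exchange η x = η ∘ Equiv.swap x z := by
  classical
  have hex := exists_nat_of_lt h.1 h.2.1
  have h2 := firstOpp_find hex
  have : exchange η x = η ∘ Equiv.swap x (x + 1 + (Nat.find hex : ℕ)) := by
    unfold exchange
    rw [dif_pos hex]
  rw [this, h2.unique h]

lemma exchange_of_not_exists {η : Config} {x : ℤ} (h : ¬ ∃ z, FirstOpp η x z) :
    exchange η x = η := by
  classical
  unfold exchange
  rw [dif_neg]
  exact fun hex => h ⟨_, firstOpp_find hex⟩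

lemma exchange_cases (η : Config) (x : ℤ) :
    exchange η x = η ∨ ∃ z, FirstOpp η x z ∧ exchange η x = η ∘ Equiv.swap x z := by
  by_cases h : ∃ z, FirstOpp η x z
  · obtain ⟨z, hz⟩ := h
    exact Or.inr ⟨z, hz, exchange_of_firstOpp hz⟩
  · exact Or.inl (exchange_of_not_exists h)

open Classical in
lemma update_eq (lam : ℝ) (η : Config) (x : ℤ) (u : ℝ) :
    update lam η x u = if Permits lam (η x) u then exchange η x else η := by
  unfold update Permits
  cases η x <;> simp

lemma update_cases (lam : ℝ) (η : Config) (x : ℤ) (u : ℝ) :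
    update lam η x u = η ∨ ∃ z, FirstOpp η x z ∧ update lam η x u = η ∘ Equiv.swap x z := by
  rw [update_eq]
  split_ifs
  · exact exchange_cases η x
  · exact Or.inl rfl

lemma rich_update {η : Config} (h : Rich η) (lam : ℝ) (x : ℤ) (u : ℝ) :
    Rich (update lam η x u) := by
  rcases update_cases lam η x u with h1 | ⟨z, hz, h1⟩
  · rwa [h1]
  · rw [h1]
    intro s y
    obtain ⟨w, hw, hs⟩ := h s (max y z)
    have := hz.1
    refine ⟨w, by omega, ?_⟩
    rw [Function.comp_apply, Equiv.swap_apply_of_ne_of_ne (by omega) (by omega), hs]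

/-- The update at `x` of the sites to the right of `x` is determined by these sites. -/
lemma update_congr {η ξ : Config} {x : ℤ} (h : ∀ y, x ≤ y → η y = ξ y) (lam u : ℝ) :
    ∀ y, x ≤ y → update lam η x u y = update lam ξ x u y := by
  intro y hy
  have key : ∀ z, FirstOpp η x z ↔ FirstOpp ξ x z := by
    intro z
    constructor <;> rintro ⟨h1, h2, h3⟩
    · refine ⟨h1, ?_, fun k hk hk' => ?_⟩
      · rwa [← h z h1.le, ← h x le_rfl]
      · rw [← h k hk.le, ← h x le_rfl, h3 k hk hk']
    · refine ⟨h1, ?_, fun k hk hk' => ?_⟩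
      · rwa [h z h1.le, h x le_rfl]
      · rw [h k hk.le, h x le_rfl, h3 k hk hk']
  rw [update_eq, update_eq, h x le_rfl]
  split_ifs
  · by_cases hex : ∃ z, FirstOpp η x z
    · obtain ⟨z, hz⟩ := hex
      rw [exchange_of_firstOpp hz, exchange_of_firstOpp ((key z).1 hz)]
      refine h _ ?_
      rcases eq_or_ne y x with rfl | hyx
      · rw [Equiv.swap_apply_left]; exact hz.1.le
      · rcases eq_or_ne y z with rfl | hyz
        · rw [Equiv.swap_apply_right]
        · rwa [Equiv.swap_apply_of_ne_of_ne hyx hyz]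
    · rw [exchange_of_not_exists hex, exchange_of_not_exists, h y hy]
      simpa only [← key] using hex
  · exact h y hy

lemma update_apply_of_lt (lam u : ℝ) (η : Config) {x y : ℤ} (h : y < x) :
    update lam η x u y = η y := by
  rcases update_cases lam η x u with h1 | ⟨z, hz, h1⟩
  · rw [h1]
  · have := hz.1
    rw [h1, Function.comp_apply, Equiv.swap_apply_of_ne_of_ne (by omega) (by omega)]

/-- An update at `x` does not reach beyond a site at which the spin differs from that at `x`. -/
lemma update_apply_of_ne {η : Config} {x z : ℤ} (hxz : x < z) (hne : η z ≠ η x) (lam u : ℝ)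
    {y : ℤ} (hy : z < y) : update lam η x u y = η y := by
  obtain ⟨w, hw, hwz⟩ := exists_firstOpp_int hxz hne
  rcases update_cases lam η x u with h1 | ⟨v, hv, h1⟩
  · rw [h1]
  · obtain rfl := hw.unique hv
    rw [h1, Function.comp_apply, Equiv.swap_apply_of_ne_of_ne (by omega) (by omega)]

/-! ### Restriction to a finite window -/

/-- The restriction of a configuration to the window `[a, b]`. -/
def restr (a b : ℤ) (η : Config) : Finset.Icc a b → Bool := fun i => η i

/-- For configurations containing both spins arbitrarily far to the right, the restriction to a
window of the update at a site of the window is the update of the restriction. -/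
lemma restr_update {η : Config} (hη : Rich η) {lam u : ℝ} {s : Bool} (hs : Permits lam s u)
    {a b : ℤ} (x : Finset.Icc a b) :
    restr a b (update lam η x u) = hop s x (restr a b η) := by
  by_cases h : η x = s
  · rw [update_eq, h, if_pos hs]
    obtain ⟨y, hy, hys⟩ := hη (!s) x
    obtain ⟨z, hz, -⟩ := exists_firstOpp_int hy (show η y ≠ η x by rw [hys, h]; simp)
    rw [exchange_of_firstOpp hz]
    have hx := Finset.mem_Icc.1 x.2
    by_cases hzb : z ≤ b
    · have hzW : z ∈ Finset.Icc a b := Finset.mem_Icc.2 ⟨by have := hz.1; omega, hzb⟩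
      have hF : FirstOpp (restr a b η) x ⟨z, hzW⟩ :=
        ⟨hz.1, hz.2.1, fun k hk hk' => hz.2.2 k hk hk'⟩
      rw [hop_of_firstOpp (η := restr a b η) h hF]
      funext i
      simp only [restr, Function.comp_apply]
      rcases eq_or_ne i x with rfl | hix
      · rw [Equiv.swap_apply_left, Equiv.swap_apply_left]
      · rcases eq_or_ne i ⟨z, hzW⟩ with rfl | hiz
        · rw [Equiv.swap_apply_right, Equiv.swap_apply_right]
        · have e : (Equiv.swap (x : ℤ) z) i = i := Equiv.swap_apply_of_ne_of_ne
            (fun hc => hix (Subtype.ext hc)) fun hc => hiz (Subtype.ext hc)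
          rw [e, Equiv.swap_apply_of_ne_of_ne]
          · exact hix
          · exact hiz
    · rw [hop_of_forall (η := restr a b η) h]
      · funext i
        have hi := Finset.mem_Icc.1 i.2
        simp only [restr, Function.comp_apply]
        rcases eq_or_ne i x with rfl | hix
        · rw [Equiv.swap_apply_left, Function.update_self]
          have := hz.2.1
          rw [h] at this
          revert this
          cases η z <;> cases s <;> simp
        · have e : (Equiv.swap (x : ℤ) z) i = i :=
            Equiv.swap_apply_of_ne_of_ne (fun hc => hix (Subtype.ext hc)) (by omega)
          rw [e, Function.update_of_ne]
          · rfl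
          · exact hix
      · intro j hj
        have hjb := Finset.mem_Icc.1 j.2
        exact (hz.2.2 j hj (by omega)).trans h
  · rw [hop_of_ne (η := restr a b η) h, update_eq, if_neg]
    have h' : η x = !s := by revert h; cases η x <;> cases s <;> simp
    rw [h']
    unfold Permits at hs ⊢
    cases s
    · simpa using le_of_lt hs
    · simpa using le_of_lt hs

/-! ### Arrivals of regular counting paths -/

/-- The counting paths start at `0`, are monotone and right-continuous. -/
structure GoodPaths (n : ℤ → ℝ≥0 → ℕ) : Prop where
  zero : ∀ x, n x 0 = 0
  mono : ∀ x, Monotone (n x)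
  rightCont : ∀ x t, ContinuousWithinAt (n x) (Set.Ici t) t

/-- The counting paths in `[a, b]` jump at most once, and by one, in the time interval `(s, t]`. -/
def SimpleCell (n : ℤ → ℝ≥0 → ℕ) (a b : ℤ) (s t : ℝ≥0) : Prop :=
  (∀ x ∈ Finset.Icc a b, n x t = n x s) ∨
    ∃ x ∈ Finset.Icc a b, n x t = n x s + 1 ∧ ∀ y ∈ Finset.Icc a b, y ≠ x → n y t = n y s

lemma SimpleCell.mono {n : ℤ → ℝ≥0 → ℕ} {a b a' b' : ℤ} {s t : ℝ≥0} (h : SimpleCell n a b s t)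
    (ha : a ≤ a') (hb : b' ≤ b) : SimpleCell n a' b' s t := by
  have hsub : Finset.Icc a' b' ⊆ Finset.Icc a b := Finset.Icc_subset_Icc ha hb
  rcases h with h | ⟨x, hx, h1, h2⟩
  · exact Or.inl fun x hx => h x (hsub hx)
  · by_cases hx' : x ∈ Finset.Icc a' b'
    · exact Or.inr ⟨x, hx', h1, fun y hy => h2 y (hsub hy)⟩
    · exact Or.inl fun y hy => h2 y (hsub hy) fun hc => hx' (hc ▸ hy)

variable {n : ℤ → ℝ≥0 → ℕ}

lemma arrivalSet_finite (hn : ∀ x, Monotone (n x)) (L : ℕ) (R : ℤ) (t : ℝ≥0) :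
    (arrivalSet n L R t).Finite := by
  have hsub : arrivalSet n L R t ⊆ ⋃ x ∈ Finset.Icc (-(L : ℤ)) R,
      (fun r => toLex (r, x)) '' {r | r ≤ t ∧ IsArrival (n x) r} := by
    rintro q ⟨h1, h2, h3, h4⟩
    simp only [Set.mem_iUnion, Finset.mem_Icc]
    exact ⟨(ofLex q).2, ⟨h2, h3⟩, (ofLex q).1, ⟨h1, h4⟩, rfl⟩
  refine Set.Finite.subset (Set.Finite.biUnion (Finset.finite_toSet _) fun x _ => ?_) hsub
  refine Set.Finite.image _ ?_
  refine Set.Finite.of_finite_image ((Set.finite_Iic (n x t)).subset ?_)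
    (f := n x) ?_
  · rintro _ ⟨r, ⟨hr, -⟩, rfl⟩
    exact hn x hr
  · rintro r ⟨-, hr⟩ s ⟨-, hs⟩ hrs
    rcases lt_trichotomy r s with h | h | h
    · exact absurd hrs (hs.2 r h).ne
    · exact h
    · exact absurd hrs (hr.2 s h).ne'

lemma mem_arrivalSet {L : ℕ} {R : ℤ} {t : ℝ≥0} {q : ℝ≥0 ×ₗ ℤ} :
    q ∈ arrivalSet n L R t ↔ (ofLex q).1 ≤ t ∧ -(L : ℤ) ≤ (ofLex q).2 ∧ (ofLex q).2 ≤ R ∧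
      IsArrival (n (ofLex q).2) (ofLex q).1 := Iff.rfl

lemma windowState_congr {lam : ℝ} {u : ℤ × ℕ → ℝ} {σ₀ : Config} {L : ℕ} {R : ℤ} {s t : ℝ≥0}
    (h : arrivalSet n L R s = arrivalSet n L R t) :
    windowState lam n u σ₀ L R s = windowState lam n u σ₀ L R t := by
  have : arrivalList n L R s = arrivalList n L R t := by
    unfold arrivalList
    congr! 3
  rw [windowState, this, windowState]

lemma sort_insert_of_forall_lt {α : Type*} [LinearOrder α] {s : Finset α} {a : α}
    (h : ∀ b ∈ s, b < a) : (insert a s).sort (· ≤ ·) = s.sort (· ≤ ·) ++ [a] := by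
  refine List.Perm.eq_of_pairwise' (r := (· ≤ ·)) (Finset.pairwise_sort _ _) ?_ ?_
  · rw [List.pairwise_append]
    refine ⟨Finset.pairwise_sort _ _, List.pairwise_singleton _ _, ?_⟩
    intro b hb c hc
    rw [List.mem_singleton.1 hc]
    exact (h b (by simpa using hb)).le
  · rw [List.perm_ext_iff_of_nodup (Finset.sort_nodup _ _)]
    · intro b
      simp [or_comm]
    · rw [List.nodup_append]
      refine ⟨Finset.sort_nodup _ _, List.nodup_singleton _, ?_⟩
      intro b hb c hc
      rw [List.mem_singleton.1 hc]
      exact (h b (by simpa using hb)).ne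

lemma windowState_insert {lam : ℝ} {u : ℤ × ℕ → ℝ} {σ₀ : Config} {L : ℕ} {R : ℤ} {s t : ℝ≥0}
    {q : ℝ≥0 ×ₗ ℤ} (hfin : (arrivalSet n L R t).Finite)
    (h : arrivalSet n L R t = insert q (arrivalSet n L R s))
    (hlt : ∀ r ∈ arrivalSet n L R s, r < q) :
    windowState lam n u σ₀ L R t = update lam (windowState lam n u σ₀ L R s) (ofLex q).2
      (u ((ofLex q).2, n (ofLex q).2 (ofLex q).1)) := by
  classical
  have hfs : (arrivalSet n L R s).Finite := hfin.subset (h ▸ Set.subset_insert _ _)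
  have e : arrivalList n L R t = arrivalList n L R s ++ [q] := by
    unfold arrivalList
    rw [dif_pos hfin, dif_pos hfs, ← sort_insert_of_forall_lt]
    · congr 1
      ext r
      simp [h]
    · simpa using hlt
  rw [windowState, e, List.foldl_append]
  rfl

lemma not_isArrival {m : ℝ≥0 → ℕ} (hm : Monotone m) {s t r : ℝ≥0} (h : m t = m s) (hs : s < r)
    (hr : r ≤ t) : ¬ IsArrival m r := fun ha => by
  have h1 := ha.2 s hs
  have h2 := hm hr
  omega

lemma arrivalSet_eq_of_forall (hn : ∀ x, Monotone (n x)) {L : ℕ} {R : ℤ} {s t : ℝ≥0} (hst : s ≤ t)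
    (h : ∀ x ∈ Finset.Icc (-(L : ℤ)) R, n x t = n x s) :
    arrivalSet n L R t = arrivalSet n L R s := by
  ext q
  rw [mem_arrivalSet, mem_arrivalSet]
  constructor
  · rintro ⟨h1, h2, h3, h4⟩
    refine ⟨?_, h2, h3, h4⟩
    by_contra hc
    exact not_isArrival (hn _) (h _ (Finset.mem_Icc.2 ⟨h2, h3⟩)) (not_le.1 hc) h1 h4
  · rintro ⟨h1, h2⟩
    exact ⟨h1.trans hst, h2⟩

/-- A monotone right-continuous counting path reaches each of its values for a first time. -/
lemma exists_first_time {m : ℝ≥0 → ℕ} (hm : Monotone m)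
    (hr : ∀ t, ContinuousWithinAt m (Set.Ici t) t) {s t : ℝ≥0} (h : m s < m t) :
    ∃ r, s < r ∧ r ≤ t ∧ m r = m t ∧ ∀ v < r, m v < m t := by
  set S : Set ℝ≥0 := {v | m t ≤ m v} with hS
  have hne : S.Nonempty := ⟨t, le_refl (m t)⟩
  have hlow : ∀ v < sInf S, m v < m t := fun v hv => by
    by_contra hc
    exact absurd (csInf_le (OrderBot.bddBelow S) (not_lt.1 hc)) (not_le.2 hv)
  have hle : sInf S ≤ t := csInf_le (OrderBot.bddBelow S) (le_refl (m t))
  have hmem : m t ≤ m (sInf S) := by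
    by_contra hc
    have hev : ∀ᶠ v in 𝓝[≥] (sInf S), m v < m t :=
      (hr (sInf S)).eventually (eventually_lt_nhds (not_le.1 hc))
    obtain ⟨w, hw, hsub⟩ := mem_nhdsGE_iff_exists_Ico_subset.1 hev
    have : w ≤ sInf S := by
      refine le_csInf hne fun v hv => ?_
      by_contra hvw
      have h3 : m v < m t := hsub ⟨csInf_le (OrderBot.bddBelow S) hv, not_le.1 hvw⟩
      exact absurd h3 (not_lt.2 hv)
    exact absurd hw (not_lt.2 this)
  refine ⟨sInf S, ?_, hle, le_antisymm (hm hle) hmem, hlow⟩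
  by_contra hc
  have := hm (not_lt.1 hc)
  omega

/-- A single jump in a time interval extends the arrivals by a single later arrival. -/
lemma arrivalSet_of_jump (hn : GoodPaths n) {L : ℕ} {R : ℤ} {s t : ℝ≥0}
    {x : ℤ} (hx : x ∈ Finset.Icc (-(L : ℤ)) R) (h1 : n x t = n x s + 1)
    (h2 : ∀ y ∈ Finset.Icc (-(L : ℤ)) R, y ≠ x → n y t = n y s) :
    ∃ r, s < r ∧ n x r = n x t ∧
      arrivalSet n L R t = insert (toLex (r, x)) (arrivalSet n L R s) := by
  obtain ⟨r, hsr, hrt, hr, hlow⟩ := exists_first_time (hn.mono x) (hn.rightCont x)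
    (show n x s < n x t by omega)
  refine ⟨r, hsr, hr, ?_⟩
  have hx' := Finset.mem_Icc.1 hx
  have harr : IsArrival (n x) r := ⟨hsr.pos, fun v hv => by rw [hr]; exact hlow v hv⟩
  ext q
  rw [Set.mem_insert_iff, mem_arrivalSet, mem_arrivalSet]
  constructor
  · rintro ⟨q1, q2, q3, q4⟩
    rcases lt_or_ge s (ofLex q).1 with hq | hq
    · left
      have hqx : (ofLex q).2 = x := by
        by_contra hqx
        exact not_isArrival (hn.mono _) (h2 _ (Finset.mem_Icc.2 ⟨q2, q3⟩) hqx) hq q1 q4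
      have hqr : (ofLex q).1 = r := by
        rw [hqx] at q4
        have b1 := q4.2 s hq
        have b2 := hn.mono x q1
        refine le_antisymm ?_ ?_
        · by_contra hc
          have := q4.2 r (not_le.1 hc)
          omega
        · by_contra hc
          have := hlow _ (not_le.1 hc)
          omega
      rw [← hqx, ← hqr]
      rfl
    · exact Or.inr ⟨hq, q2, q3, q4⟩
  · rintro (rfl | ⟨q1, q2⟩)
    · exact ⟨hrt, hx'.1, hx'.2, harr⟩
    · exact ⟨q1.trans (hsr.le.trans hrt), q2⟩

/-- The state of the window during a simple cell: either nothing happens or there is one update. -/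
lemma windowState_of_jump (hn : GoodPaths n) {lam : ℝ} {u : ℤ × ℕ → ℝ} {σ₀ : Config}
    {L : ℕ} {R : ℤ} {s t : ℝ≥0}
    {x : ℤ} (hx : x ∈ Finset.Icc (-(L : ℤ)) R) (h1 : n x t = n x s + 1)
    (h2 : ∀ y ∈ Finset.Icc (-(L : ℤ)) R, y ≠ x → n y t = n y s) :
    windowState lam n u σ₀ L R t = update lam (windowState lam n u σ₀ L R s) x (u (x, n x t)) := by
  obtain ⟨r, hsr, hr, hins⟩ := arrivalSet_of_jump hn hx h1 h2
  have := windowState_insert (lam := lam) (u := u) (σ₀ := σ₀) (arrivalSet_finite hn.mono L R t) hins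
    (fun q hq => Prod.Lex.lt_iff.2 (Or.inl (lt_of_le_of_lt hq.1 hsr)))
  rw [this]
  simp [hr]

lemma windowState_of_forall_eq (hn : GoodPaths n) {lam : ℝ} {u : ℤ × ℕ → ℝ} {σ₀ : Config}
    {L : ℕ} {R : ℤ} {s t : ℝ≥0} (hst : s ≤ t)
    (h : ∀ x ∈ Finset.Icc (-(L : ℤ)) R, n x t = n x s) :
    windowState lam n u σ₀ L R t = windowState lam n u σ₀ L R s :=
  windowState_congr (arrivalSet_eq_of_forall hn.mono hst h)

/-- At each time of a simple cell, the counting paths have their values at one of its ends. -/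
lemma SimpleCell.eq_or_eq (hn : ∀ x, Monotone (n x)) {a b : ℤ} {s t v : ℝ≥0}
    (h : SimpleCell n a b s t) (hsv : s ≤ v) (hvt : v ≤ t) :
    (∀ x ∈ Finset.Icc a b, n x v = n x s) ∨ ∀ x ∈ Finset.Icc a b, n x t = n x v := by
  have key : ∀ x, n x t = n x s → n x v = n x s ∧ n x t = n x v := fun x hx => by
    have h1 := hn x hsv
    have h2 := hn x hvt
    omega
  rcases h with h | ⟨x, hx, h1, h2⟩
  · exact Or.inl fun x hx => (key x (h x hx)).1
  · have h3 := hn x hsv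
    have h4 := hn x hvt
    have h5 : n x v = n x s ∨ n x t = n x v := by omega
    rcases h5 with h5 | h5
    · refine Or.inl fun y hy => ?_
      rcases eq_or_ne y x with rfl | hyx
      · exact h5
      · exact (key y (h2 y hy hyx)).1
    · refine Or.inr fun y hy => ?_
      rcases eq_or_ne y x with rfl | hyx
      · exact h5
      · exact (key y (h2 y hy hyx)).2

lemma windowState_zero {lam : ℝ} {u : ℤ × ℕ → ℝ} {σ₀ : Config} {L : ℕ} {R : ℤ} :
    windowState lam n u σ₀ L R 0 = σ₀ := by
  have h : arrivalSet n L R 0 = ∅ := by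
    ext q
    simp only [mem_arrivalSet, Set.mem_empty_iff_false, iff_false]
    rintro ⟨h1, -, -, h2, -⟩
    exact absurd h1 (not_le.2 h2)
  have : arrivalList n L R 0 = [] := by
    unfold arrivalList
    simp [h]
  rw [windowState, this]
  rfl

lemma rich_windowState {lam : ℝ} {u : ℤ × ℕ → ℝ} {σ₀ : Config} (h : Rich σ₀) (L : ℕ) (R : ℤ)
    (t : ℝ≥0) : Rich (windowState lam n u σ₀ L R t) := by
  unfold windowState
  generalize arrivalList n L R t = l
  induction l generalizing σ₀ with
  | nil => exact h
  | cons q l ih => exact ih (rich_update h _ _ _)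

/-! ### The law of the noise -/

section Noise

variable {Ω : Type*} [MeasurableSpace Ω] {P : Measure Ω} {N : ℤ → ℝ≥0 → Ω → ℕ}
  {U : ℤ × ℕ → Ω → ℝ}

lemma IsNoise.ae_goodPaths (h : IsNoise N U P) : ∀ᵐ ω ∂P, GoodPaths fun x r => N x r ω := by
  have h1 : ∀ᵐ ω ∂P, ∀ x, N x 0 ω = 0 := ae_all_iff.2 fun x => (h.poisson x).zero
  have h2 : ∀ᵐ ω ∂P, ∀ x, Monotone fun t => N x t ω := ae_all_iff.2 fun x => (h.poisson x).mono
  have h3 : ∀ᵐ ω ∂P, ∀ x, ∀ t, ContinuousWithinAt (fun s => N x s ω) (Set.Ici t) t :=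
    ae_all_iff.2 fun x => (h.poisson x).rightCont
  filter_upwards [h1, h2, h3] with ω a1 a2 a3
  exact ⟨a1, a2, a3⟩

lemma IsNoise.measurable_inc (h : IsNoise N U P) (x : ℤ) (s t : ℝ≥0) :
    Measurable fun ω => N x t ω - N x s ω :=
  ((h.poisson x).measurable t).sub ((h.poisson x).measurable s)

lemma IsNoise.measure_inc_eq (h : IsNoise N U P) (x : ℤ) {s t : ℝ≥0} (hst : s ≤ t) (c : ℕ) :
    P ((fun ω => N x t ω - N x s ω) ⁻¹' {c}) =
      ENNReal.ofReal (Real.exp (-(t - s : ℝ≥0)) * (t - s : ℝ≥0) ^ c / c.factorial) := by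
  rw [← Measure.map_apply (h.measurable_inc x s t) (measurableSet_singleton c),
    (h.poisson x).increments s t hst, poissonMeasure_singleton]

lemma IsNoise.measure_one_le_inc [IsProbabilityMeasure P] (h : IsNoise N U P) (x : ℤ) {s t : ℝ≥0}
    (hst : s ≤ t) : P ((fun ω => N x t ω - N x s ω) ⁻¹' {0}ᶜ) ≤ (t - s : ℝ≥0) := by
  rw [Set.preimage_compl, prob_compl_eq_one_sub
    (h.measurable_inc x s t (measurableSet_singleton 0)), h.measure_inc_eq x hst]
  set d : ℝ≥0 := t - s
  rw [tsub_le_iff_right, ← ENNReal.ofReal_coe_nnreal, ← ENNReal.ofReal_add (by positivity)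
    (by positivity), ← ENNReal.ofReal_one]
  refine ENNReal.ofReal_le_ofReal ?_
  have := Real.add_one_le_exp (-(d : ℝ))
  simp only [pow_zero, mul_one, Nat.factorial_zero, Nat.cast_one, div_one]
  linarith

lemma IsNoise.measure_two_le_inc [IsProbabilityMeasure P] (h : IsNoise N U P) (x : ℤ) {s t : ℝ≥0}
    (hst : s ≤ t) : P ((fun ω => N x t ω - N x s ω) ⁻¹' {0, 1}ᶜ) ≤ (t - s : ℝ≥0) ^ 2 := by
  rw [Set.preimage_compl, prob_compl_eq_one_sub
    (h.measurable_inc x s t (Set.toFinite _).measurableSet), Set.insert_eq, Set.preimage_union,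
    measure_union (Disjoint.preimage _ (by simp))
      (h.measurable_inc x s t (measurableSet_singleton 1)),
    h.measure_inc_eq x hst, h.measure_inc_eq x hst]
  set d : ℝ≥0 := t - s
  rw [tsub_le_iff_right, ← ENNReal.ofReal_coe_nnreal, ← ENNReal.ofReal_pow (by positivity),
    ← ENNReal.ofReal_add (by positivity) (by positivity),
    ← ENNReal.ofReal_add (by positivity) (by positivity), ← ENNReal.ofReal_one]
  refine ENNReal.ofReal_le_ofReal ?_
  have h1 := Real.add_one_le_exp (-(d : ℝ))
  have h2 : (0 : ℝ) ≤ d := d.2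
  simp only [pow_zero, mul_one, Nat.factorial_zero, Nat.cast_one, div_one, pow_one,
    Nat.factorial_one]
  nlinarith

/-- Two arrivals in a window during a short time interval are unlikely. -/
lemma IsNoise.measure_not_simpleCell_le [IsProbabilityMeasure P] (h : IsNoise N U P) (a b : ℤ)
    {s t : ℝ≥0} (hst : s ≤ t) :
    P {ω | ¬ SimpleCell (fun x r => N x r ω) a b s t} ≤
      (Finset.Icc a b).card ^ 2 * ((t - s : ℝ≥0) : ℝ≥0∞) ^ 2 := by
  classical
  set W := Finset.Icc a b
  set I : ℤ → Ω → ℕ := fun x ω => N x t ω - N x s ω with hI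
  set B : ℤ × ℤ → Set Ω := fun p =>
    if p.1 = p.2 then I p.1 ⁻¹' {0, 1}ᶜ else I p.1 ⁻¹' {0}ᶜ ∩ I p.2 ⁻¹' {0}ᶜ with hB
  have hsub : {ω | ¬ SimpleCell (fun x r => N x r ω) a b s t} ≤ᵐ[P] ⋃ p ∈ W ×ˢ W, B p := by
    filter_upwards [h.ae_goodPaths] with ω hω hns
    by_contra hc
    refine hns ?_
    have hc' : ∀ x ∈ W, ∀ y ∈ W, ω ∉ B (x, y) := by
      intro x hx y hy hmem
      exact hc (Set.mem_biUnion (Finset.mem_coe.2 (Finset.mk_mem_product hx hy)) hmem)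
    have hle : ∀ x ∈ W, I x ω = 0 ∨ I x ω = 1 := by
      intro x hx
      have := hc' x hx x hx
      simp only [hB, if_true, Set.mem_preimage, Set.mem_compl_iff, Set.mem_insert_iff,
        Set.mem_singleton_iff, not_not] at this
      exact this
    have h0 : ∀ x, I x ω = 0 → N x t ω = N x s ω := by
      intro x hx
      have := hω.mono x hst
      simp only [hI] at hx this
      omega
    by_cases hall : ∀ x ∈ W, I x ω = 0
    · exact Or.inl fun x hx => h0 x (hall x hx)
    · push Not at hall
      obtain ⟨x, hx, hx0⟩ := hall
      have hx1 : I x ω = 1 := (hle x hx).resolve_left hx0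
      refine Or.inr ⟨x, hx, ?_, fun y hy hyx => h0 y ?_⟩
      · have hx2 : N x t ω - N x s ω = 1 := hx1
        show N x t ω = N x s ω + 1
        omega
      · by_contra hy0
        refine hc' y hy x hx ?_
        simp only [hB, if_neg hyx]
        exact ⟨hy0, hx0⟩
  have hBle : ∀ p, P (B p) ≤ ((t - s : ℝ≥0) : ℝ≥0∞) ^ 2 := by
    rintro ⟨x, y⟩
    simp only [hB]
    split_ifs with hxy
    · exact h.measure_two_le_inc x hst
    · have hind : IndepFun (I x) (I y) P := by
        have hm : Measurable fun f : ℝ≥0 → ℕ => f t - f s :=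
          (measurable_pi_apply t).sub (measurable_pi_apply s)
        exact (h.indep_N.indepFun hxy).comp hm hm
      rw [hind.measure_inter_preimage_eq_mul _ _ (measurableSet_singleton 0).compl
        (measurableSet_singleton 0).compl, sq]
      exact mul_le_mul' (h.measure_one_le_inc x hst) (h.measure_one_le_inc y hst)
  calc P {ω | ¬ SimpleCell (fun x r => N x r ω) a b s t}
      ≤ P (⋃ p ∈ W ×ˢ W, B p) := measure_mono_ae hsub
    _ ≤ ∑ p ∈ W ×ˢ W, P (B p) := measure_biUnion_finset_le _ _
    _ ≤ ∑ _p ∈ W ×ˢ W, ((t - s : ℝ≥0) : ℝ≥0∞) ^ 2 := Finset.sum_le_sum fun p _ => hBle p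
    _ = _ := by
      rw [Finset.sum_const, Finset.card_product, nsmul_eq_mul]
      push_cast
      ring

/-- The grid of mesh `1 / m`. -/
noncomputable def gridTime (m k : ℕ) : ℝ≥0 := k / m

lemma gridTime_mono (m : ℕ) : Monotone (gridTime m) := fun i j hij => by
  unfold gridTime
  gcongr

lemma gridTime_sub (m k : ℕ) : gridTime m (k + 1) - gridTime m k = 1 / m := by
  unfold gridTime
  push_cast
  rw [add_div, add_tsub_cancel_left]

/-- The increments over the cells of a grid are independent, for all sites and cells. -/
lemma IsNoise.measure_grid_inc (h : IsNoise N U P) (m M : ℕ) (W : Finset ℤ) (c : ℤ → ℕ → ℕ) :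
    P (⋂ x ∈ W, ⋂ k ∈ Finset.range M,
      (fun ω => N x (gridTime m (k + 1)) ω - N x (gridTime m k) ω) ⁻¹' {c x k}) =
    ∏ x ∈ W, ∏ k ∈ Finset.range M,
      P ((fun ω => N x (gridTime m (k + 1)) ω - N x (gridTime m k) ω) ⁻¹' {c x k}) := by
  set S : ℤ → Set (ℝ≥0 → ℕ) := fun x => ⋂ k ∈ Finset.range M,
    (fun f : ℝ≥0 → ℕ => f (gridTime m (k + 1)) - f (gridTime m k)) ⁻¹' {c x k} with hS
  have hSm : ∀ x, MeasurableSet (S x) := fun x =>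
    Finset.measurableSet_biInter _ fun k _ =>
      (show Measurable fun f : ℝ≥0 → ℕ => f (gridTime m (k + 1)) - f (gridTime m k) from
        (measurable_pi_apply _).sub (measurable_pi_apply _)) (measurableSet_singleton _)
  have h1 := h.indep_N.measure_inter_preimage_eq_mul W (sets := S) fun x _ => hSm x
  have h2 : ∀ x, (fun ω => fun t : ℝ≥0 => N x t ω) ⁻¹' S x = ⋂ k ∈ Finset.range M,
      (fun ω => N x (gridTime m (k + 1)) ω - N x (gridTime m k) ω) ⁻¹' {c x k} := by
    intro x
    simp only [hS, Set.preimage_iInter]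
    rfl
  simp only [h2] at h1
  rw [h1]
  refine Finset.prod_congr rfl fun x _ => ?_
  exact ((h.poisson x).indep.nat (gridTime_mono m)).measure_inter_preimage_eq_mul
    (Finset.range M) (sets := fun k => {c x k}) fun k _ => measurableSet_singleton _

/-- The probability that a uniform variable permits the spin `s` to move. -/
noncomputable def rate (lam : ℝ) (s : Bool) : ℝ≥0∞ :=
  ENNReal.ofReal (if s = true then lam else 1 - lam)

lemma rate_add {lam : ℝ} (h0 : 0 < lam) (h1 : lam < 1) : rate lam true + rate lam false = 1 := by
  unfold rate
  rw [← ENNReal.ofReal_add (by simpa using h0.le) (by simpa using h1.le)]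
  simp

lemma measurableSet_permits (lam : ℝ) (s : Bool) : MeasurableSet {u | Permits lam s u} := by
  cases s
  · exact (measurableSet_Ioi : MeasurableSet (Set.Ioi lam))
  · exact (measurableSet_Iio : MeasurableSet (Set.Iio lam))

lemma IsNoise.measure_permits (h : IsNoise N U P) {lam : ℝ} (h0 : 0 < lam) (h1 : lam < 1)
    (i : ℤ × ℕ) (s : Bool) : P (U i ⁻¹' {u | Permits lam s u}) = rate lam s := by
  have hv : volume (Set.Icc (0 : ℝ) 1) = 1 := by simp
  rw [(h.uniform i).measure_preimage (by simp [hv]) (by simp [hv]) (measurableSet_permits lam s),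
    hv, div_one]
  cases s
  · have : Set.Icc (0 : ℝ) 1 ∩ {u | Permits lam false u} = Set.Ioc lam 1 := by
      ext u
      simp only [Permits, Set.mem_inter_iff, Set.mem_Icc, Set.mem_ofPred_eq, Set.mem_Ioc]
      constructor
      · rintro ⟨⟨a1, a2⟩, a3⟩
        exact ⟨by simpa using a3, a2⟩
      · rintro ⟨a1, a2⟩
        exact ⟨⟨by linarith, a2⟩, by simpa using a1⟩
    rw [this]
    simp [rate]
  · have : Set.Icc (0 : ℝ) 1 ∩ {u | Permits lam true u} = Set.Ico 0 lam := by
      ext u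
      simp only [Permits, Set.mem_inter_iff, Set.mem_Icc, Set.mem_ofPred_eq, Set.mem_Ico]
      constructor
      · rintro ⟨⟨a1, a2⟩, a3⟩
        exact ⟨a1, by simpa using a3⟩
      · rintro ⟨a1, a2⟩
        exact ⟨⟨a1, by linarith⟩, by simpa using a2⟩
    rw [this]
    simp [rate]

lemma IsNoise.ae_ne (h : IsNoise N U P) (lam : ℝ) : ∀ᵐ ω ∂P, ∀ i, U i ω ≠ lam := by
  rw [ae_all_iff]
  intro i
  have hv : volume (Set.Icc (0 : ℝ) 1) = 1 := by simp
  have := (h.uniform i).measure_preimage (by simp [hv]) (by simp [hv])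
    (measurableSet_singleton lam)
  rw [hv, div_one, measure_mono_null Set.inter_subset_right Real.volume_singleton] at this
  rw [ae_iff]
  simp only [not_not]
  exact this

end Noise

/-! ### The Bernoulli measure -/

/-- The single-site weights of the Bernoulli measure. -/
noncomputable def siteWt (p : unitInterval) (s : Bool) : ℝ≥0∞ := bernoulliMeasure true false p {s}

lemma siteWt_add (p : unitInterval) : siteWt p true + siteWt p false = 1 := by
  unfold siteWt
  rw [← measure_union (by simp) (measurableSet_singleton _)]
  have : ({true} ∪ {false} : Set Bool) = Set.univ := by ext b; cases b <;> simp
  rw [this, measure_univ]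

lemma siteWt_ne_zero {p : unitInterval} (hp0 : 0 < p) (hp1 : p < 1) (s : Bool) :
    siteWt p s ≠ 0 := by
  have h0 : (0 : ℝ) < p := hp0
  have h1 : (p : ℝ) < 1 := hp1
  have : (bernoulliMeasure true false p).real {s} ≠ 0 := by
    cases s
    · rw [bernoulliMeasure_real_apply_of_notMem_of_mem _ (measurableSet_singleton _) (by simp)
        (by simp)]
      linarith
    · rw [bernoulliMeasure_real_apply_of_mem_of_notMem _ (measurableSet_singleton _) (by simp)
        (by simp)]
      exact h0.ne'
  intro hc
  refine this ?_
  rw [measureReal_def]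
  unfold siteWt at hc
  rw [hc, ENNReal.toReal_zero]

lemma siteWt_le_one (p : unitInterval) (s : Bool) : siteWt p s ≤ 1 := prob_le_one

lemma exists_siteWt_le_mul {p : unitInterval} (hp0 : 0 < p) (hp1 : p < 1) :
    ∃ c : ℝ≥0, ∀ s, siteWt p s ≤ c * siteWt p (!s) := by
  have hfin : (siteWt p true)⁻¹ + (siteWt p false)⁻¹ ≠ ∞ :=
    ENNReal.add_ne_top.2 ⟨ENNReal.inv_ne_top.2 (siteWt_ne_zero hp0 hp1 _),
      ENNReal.inv_ne_top.2 (siteWt_ne_zero hp0 hp1 _)⟩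
  refine ⟨((siteWt p true)⁻¹ + (siteWt p false)⁻¹).toNNReal, fun s => ?_⟩
  rw [ENNReal.coe_toNNReal hfin]
  calc siteWt p s ≤ 1 := siteWt_le_one p s
    _ = (siteWt p (!s))⁻¹ * siteWt p (!s) :=
      (ENNReal.inv_mul_cancel (siteWt_ne_zero hp0 hp1 _)
        (ne_top_of_le_ne_top ENNReal.one_ne_top (siteWt_le_one p _))).symm
    _ ≤ _ := by
      gcongr
      cases s
      · exact le_self_add
      · exact le_add_self

lemma siteWt_lt_one {p : unitInterval} (hp0 : 0 < p) (hp1 : p < 1) (s : Bool) :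
    siteWt p s < 1 := by
  have h := siteWt_add p
  have hs : siteWt p s + siteWt p (!s) = 1 := by
    cases s
    · rw [add_comm]; exact h
    · exact h
  rw [← hs]
  exact ENNReal.lt_add_right (ne_top_of_le_ne_top ENNReal.one_ne_top (siteWt_le_one p _))
    (siteWt_ne_zero hp0 hp1 _)

lemma exists_siteWt_le {p : unitInterval} (hp0 : 0 < p) (hp1 : p < 1) :
    ∃ r : ℝ≥0, r < 1 ∧ ∀ s, siteWt p s ≤ r := by
  have h : max (siteWt p true) (siteWt p false) < 1 :=
    max_lt (siteWt_lt_one hp0 hp1 _) (siteWt_lt_one hp0 hp1 _)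
  refine ⟨(max (siteWt p true) (siteWt p false)).toNNReal, ?_, fun s => ?_⟩
  · rw [← ENNReal.coe_lt_coe, ENNReal.coe_toNNReal h.ne_top]
    exact h
  · rw [ENNReal.coe_toNNReal h.ne_top]
    cases s
    · exact le_max_right _ _
    · exact le_max_left _ _

instance (p : unitInterval) : IsProbabilityMeasure (ber p) := by
  unfold ber
  infer_instance

lemma ber_forall_eq (p : unitInterval) (B : Finset ℤ) (f : ℤ → Bool) :
    ber p {σ | ∀ x ∈ B, σ x = f x} = ∏ x ∈ B, siteWt p (f x) := by
  have h := Measure.infinitePi_pi (fun _ : ℤ => bernoulliMeasure true false p) (s := B)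
    (t := fun x => {f x}) fun x _ => measurableSet_singleton _
  have e : {σ : Config | ∀ x ∈ B, σ x = f x} = (B : Set ℤ).pi fun x => {f x} := by
    ext σ
    simp [Set.mem_pi]
  rw [ber, e, h]
  rfl

lemma ber_restr_eq (p : unitInterval) (a b : ℤ) (η : Finset.Icc a b → Bool) :
    ber p {σ | restr a b σ = η} = wt (siteWt p) η := by
  classical
  set f : ℤ → Bool := fun x => if h : x ∈ Finset.Icc a b then η ⟨x, h⟩ else true with hf
  have e : {σ | restr a b σ = η} = {σ | ∀ x ∈ Finset.Icc a b, σ x = f x} := by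
    ext σ
    constructor
    · intro h x hx
      rw [hf]
      simp only [dif_pos hx]
      exact congrFun h ⟨x, hx⟩
    · intro h
      funext x
      have := h x x.2
      simp only [hf, dif_pos x.2] at this
      exact this
  rw [e, ber_forall_eq, wt, ← Finset.prod_coe_sort]
  refine Finset.prod_congr rfl fun x _ => ?_
  simp only [hf, dif_pos x.2]

lemma ae_rich {p : unitInterval} (hp0 : 0 < p) (hp1 : p < 1) : ∀ᵐ σ ∂(ber p), Rich σ := by
  unfold Rich
  simp only [ae_all_iff]
  intro s y
  rw [ae_iff]
  refine le_antisymm ?_ zero_le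
  have hlim : Tendsto (fun k : ℕ => siteWt p (!s) ^ k) atTop (𝓝 0) :=
    ENNReal.tendsto_pow_atTop_nhds_zero_of_lt_one (siteWt_lt_one hp0 hp1 _)
  refine ge_of_tendsto' hlim fun k => ?_
  have h := ber_forall_eq p (Finset.Ioc y (y + k)) fun _ => !s
  rw [Finset.prod_const, Int.card_Ioc, add_sub_cancel_left, Int.toNat_natCast] at h
  rw [← h]
  refine measure_mono fun σ hσ x hx => ?_
  simp only [Set.mem_ofPred_eq, not_exists, not_and] at hσ
  have := hσ x (Finset.mem_Ioc.1 hx).1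
  revert this
  cases σ x <;> cases s <;> simp

/-! ### The law of the arrivals on a grid -/

section WordEvents

variable {Ω : Type*} [MeasurableSpace Ω] {P : Measure Ω} {N : ℤ → ℝ≥0 → Ω → ℕ}
  {U : ℤ × ℕ → Ω → ℝ} {a b : ℤ} {M : ℕ}

/-- The increment at `x` that is prescribed by a letter. -/
def letterInc (l : Option (Finset.Icc a b × Bool)) (x : ℤ) : ℕ :=
  l.elim 0 fun y => if (y.1 : ℤ) = x then 1 else 0

/-- The increment at `x` in the `k`-th cell of the grid that is prescribed by a word. -/
def wordInc (w : Fin M → Option (Finset.Icc a b × Bool)) (x : ℤ) (k : ℕ) : ℕ :=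
  if h : k < M then letterInc (w ⟨k, h⟩) x else 0

/-- The index of the uniform variable that is used at the arrival in the `k`-th cell. For a cell
without arrivals it is an index at the site `b + 1` outside of the window, which is not used
otherwise. -/
def wordIdx (w : Fin M → Option (Finset.Icc a b × Bool)) (k : Fin M) : ℤ × ℕ :=
  (w k).elim (b + 1, (k : ℕ)) fun y => ((y.1 : ℤ), ∑ j ∈ Finset.range (k + 1), wordInc w y.1 j)

/-- The values of the uniform variable that permit the move prescribed by a letter. -/
def letterEvent (lam : ℝ) (l : Option (Finset.Icc a b × Bool)) : Set ℝ :=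
  l.elim Set.univ fun y => {u | Permits lam y.2 u}

lemma wordInc_self (w : Fin M → Option (Finset.Icc a b × Bool)) {k : Fin M}
    {y : Finset.Icc a b × Bool} (h : w k = some y) : wordInc w y.1 k = 1 := by
  simp [wordInc, k.2, h, letterInc]

lemma wordIdx_injective (w : Fin M → Option (Finset.Icc a b × Bool)) :
    Function.Injective (wordIdx w) := by
  have key : ∀ (k k' : Fin M) (y : Finset.Icc a b × Bool), w k' = some y → k < k' →
      ∑ j ∈ Finset.range (k + 1), wordInc w y.1 j <
        ∑ j ∈ Finset.range (k' + 1), wordInc w y.1 j := by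
    intro k k' y hk hlt
    have hlt' : (k : ℕ) < k' := hlt
    rw [Finset.sum_range_succ _ (k' : ℕ), wordInc_self w hk]
    exact Nat.lt_succ_of_le (Finset.sum_le_sum_of_subset (Finset.range_mono hlt'))
  have main : ∀ k k' : Fin M, k < k' → wordIdx w k ≠ wordIdx w k' := by
    intro k k' hlt h
    have hlt' : (k : ℕ) < k' := hlt
    unfold wordIdx at h
    cases hk : w k with
    | none =>
      cases hk' : w k' with
      | none =>
        simp only [hk, hk', Option.elim_none, Prod.mk.injEq] at h
        omega
      | some y =>
        simp only [hk, hk', Option.elim_none, Option.elim_some, Prod.mk.injEq] at h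
        have := (Finset.mem_Icc.1 y.1.2).2
        omega
    | some y =>
      cases hk' : w k' with
      | none =>
        simp only [hk, hk', Option.elim_none, Option.elim_some, Prod.mk.injEq] at h
        have := (Finset.mem_Icc.1 y.1.2).2
        omega
      | some y' =>
        simp only [hk, hk', Option.elim_some, Prod.mk.injEq] at h
        have := key k k' y' hk' hlt
        rw [h.1] at h
        omega
  intro k k' h
  rcases lt_trichotomy k k' with hlt | he | hlt
  · exact absurd h (main k k' hlt)
  · exact he
  · exact absurd h.symm (main k' k hlt)

/-- The event that the initial configuration is `η` in the window, and that the noise during the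
first `M` cells of the grid of mesh `1 / m` is described by the word `w`. -/
def wordEvent (N : ℤ → ℝ≥0 → Ω → ℕ) (U : ℤ × ℕ → Ω → ℝ) (lam : ℝ) (m : ℕ)
    (w : Fin M → Option (Finset.Icc a b × Bool)) (η : Finset.Icc a b → Bool) : Set (Config × Ω) :=
  {σ | restr a b σ = η} ×ˢ
    ((⋂ x ∈ Finset.Icc a b, ⋂ k ∈ Finset.range M,
      (fun ω => N x (gridTime m (k + 1)) ω - N x (gridTime m k) ω) ⁻¹' {wordInc w x k}) ∩
    ⋂ k ∈ (Finset.univ : Finset (Fin M)), U (wordIdx w k) ⁻¹' letterEvent lam (w k))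

lemma letterInc_le_one (l : Option (Finset.Icc a b × Bool)) (x : ℤ) : letterInc l x ≤ 1 := by
  cases l with
  | none => simp [letterInc]
  | some y =>
    simp only [letterInc, Option.elim_some]
    split_ifs <;> simp

lemma wordInc_le_one (w : Fin M → Option (Finset.Icc a b × Bool)) (x : ℤ) (k : ℕ) :
    wordInc w x k ≤ 1 := by
  unfold wordInc
  split_ifs
  · exact letterInc_le_one _ _
  · simp

lemma IsNoise.measure_inc_le_one (h : IsNoise N U P) (m k : ℕ) (x : ℤ) {c : ℕ} (hc : c ≤ 1) :
    P ((fun ω => N x (gridTime m (k + 1)) ω - N x (gridTime m k) ω) ⁻¹' {c}) =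
      ENNReal.ofReal (Real.exp (-(1 / m : ℝ))) * ENNReal.ofReal (1 / m) ^ c := by
  rw [h.measure_inc_eq x (gridTime_mono m (Nat.le_succ k)), gridTime_sub,
    ← ENNReal.ofReal_pow (by positivity), ← ENNReal.ofReal_mul (by positivity)]
  congr 1
  have : c.factorial = 1 := by interval_cases c <;> rfl
  rw [this]
  push_cast
  ring

lemma IsNoise.measure_wordEvent [IsProbabilityMeasure P] (h : IsNoise N U P) {lam : ℝ}
    (h0 : 0 < lam) (h1 : lam < 1) (p : unitInterval) (m : ℕ)
    (w : Fin M → Option (Finset.Icc a b × Bool)) (η : Finset.Icc a b → Bool) :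
    (ber p).prod P (wordEvent N U lam m w η) =
      ENNReal.ofReal (Real.exp (-(1 / m : ℝ))) ^ ((Finset.Icc a b).card * M) *
        (wt (siteWt p) η * ∏ k, letterWt (ENNReal.ofReal (1 / m)) (rate lam) (w k)) := by
  set E := ENNReal.ofReal (Real.exp (-(1 / m : ℝ)))
  set D := ENNReal.ofReal (1 / m)
  rw [wordEvent, Measure.prod_prod, ber_restr_eq]
  set SN : Set (ℤ → ℝ≥0 → ℕ) := ⋂ x ∈ Finset.Icc a b, ⋂ k ∈ Finset.range M,
    {f | f x (gridTime m (k + 1)) - f x (gridTime m k) = wordInc w x k} with hSN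
  set SU : Set (ℤ × ℕ → ℝ) := ⋂ k ∈ (Finset.univ : Finset (Fin M)),
    {g | g (wordIdx w k) ∈ letterEvent lam (w k)} with hSU
  have hle : ∀ l : Option (Finset.Icc a b × Bool), MeasurableSet (letterEvent lam l) := by
    intro l
    cases l with
    | none => exact MeasurableSet.univ
    | some y => exact measurableSet_permits lam y.2
  have hSNm : MeasurableSet SN :=
    Finset.measurableSet_biInter _ fun x _ => Finset.measurableSet_biInter _ fun k _ =>
      (show Measurable fun f : ℤ → ℝ≥0 → ℕ => f x (gridTime m (k + 1)) - f x (gridTime m k) by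
        fun_prop) (measurableSet_singleton _)
  have hSUm : MeasurableSet SU :=
    Finset.measurableSet_biInter _ fun k _ => (measurable_pi_apply (wordIdx w k)) (hle (w k))
  have hind := h.indep_N_U.measure_inter_preimage_eq_mul SN SU hSNm hSUm
  have eN : (fun (ω : Ω) => fun (x : ℤ) (t : ℝ≥0) => N x t ω) ⁻¹' SN =
      ⋂ x ∈ Finset.Icc a b, ⋂ k ∈ Finset.range M,
      (fun ω => N x (gridTime m (k + 1)) ω - N x (gridTime m k) ω) ⁻¹' {wordInc w x k} := by
    simp only [hSN, Set.preimage_iInter]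
    rfl
  have eU : (fun (ω : Ω) => fun i => U i ω) ⁻¹' SU =
      ⋂ k ∈ (Finset.univ : Finset (Fin M)), U (wordIdx w k) ⁻¹' letterEvent lam (w k) := by
    simp only [hSU, Set.preimage_iInter]
    rfl
  rw [eN, eU] at hind
  rw [hind, h.measure_grid_inc, (h.indep_U.precomp (wordIdx_injective w)).measure_inter_preimage_eq_mul
    Finset.univ (sets := fun k => letterEvent lam (w k)) fun k _ => hle (w k)]
  have hN : (∏ x ∈ Finset.Icc a b, ∏ k ∈ Finset.range M,
      P ((fun ω => N x (gridTime m (k + 1)) ω - N x (gridTime m k) ω) ⁻¹' {wordInc w x k})) =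
      E ^ ((Finset.Icc a b).card * M) * ∏ k : Fin M, D ^ (if w k = none then 0 else 1) := by
    have e1 : ∀ x k, P ((fun ω => N x (gridTime m (k + 1)) ω - N x (gridTime m k) ω) ⁻¹'
        {wordInc w x k}) = E * D ^ wordInc w x k := fun x k =>
      h.measure_inc_le_one m k x (wordInc_le_one w x k)
    simp_rw [e1, Finset.prod_mul_distrib, Finset.prod_const, Finset.card_range, ← pow_mul]
    rw [mul_comm M, Finset.prod_comm, ← Fin.prod_univ_eq_prod_range
      (fun k => ∏ x ∈ Finset.Icc a b, D ^ wordInc w x k) M]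
    congr 1
    refine Finset.prod_congr rfl fun k _ => ?_
    rw [Finset.prod_pow_eq_pow_sum]
    congr 1
    simp only [wordInc, k.2, dif_pos, Fin.eta]
    cases hk : w k with
    | none => simp [letterInc]
    | some y =>
      simp only [letterInc, Option.elim_some, reduceCtorEq, if_false]
      rw [Finset.sum_ite_eq, if_pos y.1.2]
  rw [hN]
  have hU : ∀ k : Fin M, P (U (wordIdx w k) ⁻¹' letterEvent lam (w k)) =
      (w k).elim 1 fun y => rate lam y.2 := by
    intro k
    cases hk : w k with
    | none => simp [letterEvent]
    | some y => exact h.measure_permits h0 h1 _ _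
  simp_rw [hU]
  rw [mul_assoc (E ^ _), ← Finset.prod_mul_distrib, mul_left_comm]
  congr 2
  refine Finset.prod_congr rfl fun k _ => ?_
  cases hk : w k with
  | none => simp [letterWt]
  | some y => simp [letterWt]

/-- During simple cells the restricted dynamics follows a word. -/
lemma exists_word {n : ℤ → ℝ≥0 → ℕ} (hn : GoodPaths n) {u : ℤ × ℕ → ℝ} {lam : ℝ}
    (hu : ∀ i, u i ≠ lam) {σ₀ : Config} (hσ : Rich σ₀) {L : ℕ} {R : ℤ} {m : ℕ}
    (hs : ∀ k < M, SimpleCell n (-(L : ℤ)) R (gridTime m k) (gridTime m (k + 1))) :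
    ∃ w : Fin M → Option (Finset.Icc (-(L : ℤ)) R × Bool),
      (∀ x ∈ Finset.Icc (-(L : ℤ)) R, ∀ k < M,
        n x (gridTime m (k + 1)) - n x (gridTime m k) = wordInc w x k) ∧
      (∀ k, u (wordIdx w k) ∈ letterEvent lam (w k)) ∧
      ∀ k : Fin M, restr (-(L : ℤ)) R (windowState lam n u σ₀ L R (gridTime m (k + 1))) =
        act (w k) (restr (-(L : ℤ)) R (windowState lam n u σ₀ L R (gridTime m k))) := by
  have hstep : ∀ k : Fin M, ∃ l : Option (Finset.Icc (-(L : ℤ)) R × Bool),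
      (∀ x ∈ Finset.Icc (-(L : ℤ)) R,
        n x (gridTime m (k + 1)) = n x (gridTime m k) + letterInc l x) ∧
      (∀ y, l = some y → Permits lam y.2 (u (y.1, n y.1 (gridTime m (k + 1))))) ∧
      restr (-(L : ℤ)) R (windowState lam n u σ₀ L R (gridTime m (k + 1))) =
        act l (restr (-(L : ℤ)) R (windowState lam n u σ₀ L R (gridTime m k))) := by
    intro k
    have hle := gridTime_mono m (Nat.le_succ k)
    rcases hs k k.2 with h | ⟨x, hx, h1, h2⟩
    · refine ⟨none, fun x hx => ?_, by simp, ?_⟩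
      · simpa [letterInc] using h x hx
      · rw [windowState_of_forall_eq hn hle h]
        rfl
    · obtain ⟨s, hsP⟩ : ∃ s, Permits lam s (u (x, n x (gridTime m (k + 1)))) := by
        rcases lt_or_gt_of_ne (hu (x, n x (gridTime m (k + 1)))) with h | h
        · exact ⟨true, by simpa [Permits] using h⟩
        · exact ⟨false, by simpa [Permits] using h⟩
      refine ⟨some (⟨x, hx⟩, s), fun y hy => ?_, ?_, ?_⟩
      · rcases eq_or_ne y x with rfl | hyx
        · simpa [letterInc] using h1
        · simpa [letterInc, hyx.symm] using h2 y hy hyx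
      · rintro _ ⟨⟩
        exact hsP
      · rw [windowState_of_jump hn hx h1 h2]
        exact restr_update (rich_windowState hσ L R _) hsP ⟨x, hx⟩
  choose w hw1 hw2 hw3 using hstep
  have hinc : ∀ x ∈ Finset.Icc (-(L : ℤ)) R, ∀ k, k < M →
      n x (gridTime m (k + 1)) = n x (gridTime m k) + wordInc w x k := by
    intro x hx k hk
    rw [wordInc, dif_pos hk]
    exact hw1 ⟨k, hk⟩ x hx
  -- the prescribed increments identify the uniform variables that are used
  have hcum : ∀ x ∈ Finset.Icc (-(L : ℤ)) R, ∀ k, k ≤ M →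
      n x (gridTime m k) = ∑ j ∈ Finset.range k, wordInc w x j := by
    intro x hx k hk
    induction k with
    | zero => simp [gridTime, hn.zero]
    | succ k ih => rw [Finset.sum_range_succ, ← ih (by omega), hinc x hx k (by omega)]
  refine ⟨w, fun x hx k hk => ?_, fun k => ?_, hw3⟩
  · rw [hinc x hx k hk]
    omega
  · unfold letterEvent wordIdx
    cases hk : w k with
    | none => exact Set.mem_univ _
    | some y =>
      have := hw2 k y hk
      rw [hcum y.1 y.1.2 (k + 1) k.2] at this
      simpa using this

end WordEvents

/-! ### Blocking of the influence of a distant site -/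

/-- Some `K + 1` consecutive sites of `[a, b]` carry the same spin. -/
def HasRun (K : ℕ) (a b : ℤ) (η : Config) : Prop :=
  ∃ s y, a ≤ y ∧ y + K ≤ b ∧ ∀ z, y ≤ z → z ≤ y + K → η z = s

lemma exists_ne_of_not_hasRun {K : ℕ} {a b : ℤ} {η : Config} (h : ¬ HasRun K a b η) {y : ℤ}
    (h1 : a ≤ y) (h2 : y + K ≤ b) : ∃ z, y < z ∧ z ≤ y + K ∧ η z ≠ η y := by
  by_contra hc
  push Not at hc
  refine h ⟨η y, y, h1, h2, fun z hz hz' => ?_⟩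
  rcases hz.eq_or_lt with rfl | hlt
  · rfl
  · exact hc z hlt hz'

section Blocking

variable {n : ℤ → ℝ≥0 → ℕ} {lam : ℝ} {u : ℤ × ℕ → ℝ} {σ₀ : Config} {L K : ℕ} {x : ℤ}

/-- If there is no run of `K + 1` equal spins, then an arrival to the left of a strip of `K` sites
does not affect the sites to the right of the strip. Hence, as long as there are no arrivals in the
strip, the agreement of the two cut-off dynamics to the right of the strip persists. -/
lemma agree_step (hn : GoodPaths n) {s t : ℝ≥0} (hst : s ≤ t)
    (hs : SimpleCell n (-((L + 1 : ℕ) : ℤ)) x s t)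
    (hr : ¬ HasRun K (-(L : ℤ)) x (windowState lam n u σ₀ L x s))
    (hr' : ¬ HasRun K (-((L + 1 : ℕ) : ℤ)) x (windowState lam n u σ₀ (L + 1) x s))
    {a : ℤ} (haL : -(L : ℤ) ≤ a) (hax : a + K ≤ x) (hfree : ∀ y ∈ Finset.Ico a (a + K), n y t = n y s)
    (h : ∀ y, a + K ≤ y → windowState lam n u σ₀ L x s y = windowState lam n u σ₀ (L + 1) x s y) :
    ∀ y, a + K ≤ y →
      windowState lam n u σ₀ L x t y = windowState lam n u σ₀ (L + 1) x t y := by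
  have hsub : Finset.Icc (-(L : ℤ)) x ⊆ Finset.Icc (-((L + 1 : ℕ) : ℤ)) x :=
    Finset.Icc_subset_Icc (by push_cast; omega) le_rfl
  rcases hs with hs | ⟨w, hw, h1, h2⟩
  · rw [windowState_of_forall_eq hn hst hs,
      windowState_of_forall_eq hn hst fun y hy => hs y (hsub hy)]
    exact h
  · intro y hy
    rw [windowState_of_jump hn hw h1 h2]
    have hw' := Finset.mem_Icc.1 hw
    have hcases : w < a ∨ a + K ≤ w := by
      by_contra hc
      have := hfree w (Finset.mem_Ico.2 (by omega))
      omega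
    by_cases hwL : -(L : ℤ) ≤ w
    · rw [windowState_of_jump hn (Finset.mem_Icc.2 ⟨hwL, hw'.2⟩) h1
        fun y hy => h2 y (hsub hy)]
      rcases hcases with hwa | hwa
      · obtain ⟨z, hz1, hz2, hz3⟩ := exists_ne_of_not_hasRun hr hwL (by omega)
        obtain ⟨z', hz1', hz2', hz3'⟩ := exists_ne_of_not_hasRun hr' hw'.1 (by omega)
        rw [update_apply_of_ne hz1 hz3 _ _ (by omega), update_apply_of_ne hz1' hz3' _ _ (by omega)]
        exact h y hy
      · rcases lt_or_ge y w with hyw | hyw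
        · rw [update_apply_of_lt _ _ _ hyw, update_apply_of_lt _ _ _ hyw]
          exact h y hy
        · exact update_congr (fun z hz => h z (hwa.trans hz)) _ _ y hyw
    · rw [windowState_of_forall_eq hn hst fun y hy => h2 y (hsub hy) ?_]
      · rcases hcases with hwa | hwa
        · obtain ⟨z', hz1', hz2', hz3'⟩ := exists_ne_of_not_hasRun hr' hw'.1 (by omega)
          rw [update_apply_of_ne hz1' hz3' _ _ (by omega)]
          exact h y hy
        · omega
      · rintro rfl
        exact hwL (Finset.mem_Icc.1 hy).1

/-- Successive strips without arrivals, located further and further to the right in successive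
time intervals, block the influence of the site `-(L + 1)` on the site `x`. -/
lemma agree_of_strips (hn : GoodPaths n) {T l : ℕ} (hK : 0 < K) (hl : 0 < l)
    (hs : ∀ k < T * (K * l), SimpleCell n (-((L + 1 : ℕ) : ℤ)) x
      (gridTime (K * l) k) (gridTime (K * l) (k + 1)))
    (hr : ∀ k ≤ T * (K * l),
      ¬ HasRun K (-(L : ℤ)) x (windowState lam n u σ₀ L x (gridTime (K * l) k)))
    (hr' : ∀ k ≤ T * (K * l), ¬ HasRun K (-((L + 1 : ℕ) : ℤ)) x
      (windowState lam n u σ₀ (L + 1) x (gridTime (K * l) k)))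
    (a : ℕ → ℤ)
    (ha : ∀ i < T * K, -(L : ℤ) + i * K ^ 2 ≤ a i ∧ a i + K ≤ -(L : ℤ) + (i + 1) * K ^ 2 ∧
      ∀ y ∈ Finset.Ico (a i) (a i + K), n y (gridTime K (i + 1)) = n y (gridTime K i))
    (hx : -(L : ℤ) + T * K ^ 3 ≤ x) {s : ℝ≥0} (hsT : s < T) :
    windowState lam n u σ₀ L x s x = windowState lam n u σ₀ (L + 1) x s x := by
  have hax : ∀ i < T * K, a i + K ≤ x := by
    intro i hi
    have h1 := (ha i hi).2.1
    have h2 : ((i : ℤ) + 1) * K ^ 2 ≤ (T * K) * K ^ 2 := by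
      have : (i : ℤ) + 1 ≤ T * K := by exact_mod_cast hi
      gcongr
    nlinarith
  have hdiv : ∀ k, k < T * (K * l) → k / l < T * K := by
    intro k hk
    rw [Nat.div_lt_iff_lt_mul hl, mul_assoc]
    exact hk
  have hmul : ∀ i, gridTime (K * l) (i * l) = gridTime K i := by
    intro i
    unfold gridTime
    push_cast
    rw [mul_div_mul_right]
    exact_mod_cast hl.ne'
  have hfree : ∀ k < T * (K * l), ∀ y ∈ Finset.Ico (a (k / l)) (a (k / l) + K),
      n y (gridTime (K * l) (k + 1)) = n y (gridTime (K * l) k) := by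
    intro k hk y hy
    have h1 := (ha (k / l) (hdiv k hk)).2.2 y hy
    have h2 : gridTime K (k / l) ≤ gridTime (K * l) k := by
      rw [← hmul]
      exact gridTime_mono _ (Nat.div_mul_le_self k l)
    have h3 : gridTime (K * l) (k + 1) ≤ gridTime K (k / l + 1) := by
      rw [← hmul]
      exact gridTime_mono _ (Nat.lt_div_mul_add hl |>.trans_eq (by ring))
    have b1 := hn.mono y h2
    have b2 := hn.mono y h3
    have b3 := hn.mono y (gridTime_mono (K * l) (Nat.le_succ k))
    simp only [Nat.succ_eq_add_one] at b3
    omega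
  have hstep : ∀ k (hk : k < T * (K * l)),
      (∀ y, a (k / l) + K ≤ y → windowState lam n u σ₀ L x (gridTime (K * l) k) y =
        windowState lam n u σ₀ (L + 1) x (gridTime (K * l) k) y) →
      ∀ y, a (k / l) + K ≤ y → windowState lam n u σ₀ L x (gridTime (K * l) (k + 1)) y =
        windowState lam n u σ₀ (L + 1) x (gridTime (K * l) (k + 1)) y := fun k hk h =>
    agree_step hn (gridTime_mono _ (Nat.le_succ k)) (hs k hk) (hr k hk.le) (hr' k hk.le)
      (le_trans (le_add_of_nonneg_right (by positivity)) (ha _ (hdiv k hk)).1) (hax _ (hdiv k hk)) (hfree k hk) h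
  -- the cell `k` lies in the time interval `k / l`, whose free strip starts at `a (k / l)`
  have hagree : ∀ k < T * (K * l), ∀ y, a (k / l) + K ≤ y →
      windowState lam n u σ₀ L x (gridTime (K * l) k) y =
        windowState lam n u σ₀ (L + 1) x (gridTime (K * l) k) y := by
    intro k
    induction k with
    | zero =>
      intro hk y hy
      have : gridTime (K * l) 0 = 0 := by simp [gridTime]
      rw [this, windowState_zero, windowState_zero]
    | succ k ih =>
      intro hk y hy
      have hk' : k < T * (K * l) := by omega
      refine hstep k hk' (ih hk') y (le_trans ?_ hy)
      have hle : k / l ≤ (k + 1) / l := Nat.div_le_div_right (Nat.le_succ k)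
      rcases hle.eq_or_lt with he | hlt
      · rw [he]
      · have c1 := (ha _ (hdiv k hk')).2.1
        have c2 := (ha _ (hdiv (k + 1) hk)).1
        have c3 : ((k / l : ℕ) : ℤ) + 1 ≤ ((k + 1) / l : ℕ) := by exact_mod_cast hlt
        have c4 : (((k / l : ℕ) : ℤ) + 1) * K ^ 2 ≤ ((k + 1) / l : ℕ) * K ^ 2 := by gcongr
        have c5 : (0 : ℤ) ≤ K := by positivity
        linarith
  have hm : (0 : ℝ≥0) < ((K * l : ℕ) : ℝ≥0) := by exact_mod_cast Nat.mul_pos hK hl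
  -- the cell that contains `s`
  set k := ⌊s * ((K * l : ℕ) : ℝ≥0)⌋₊ with hkdef
  have hk1 : gridTime (K * l) k ≤ s := by
    unfold gridTime
    rw [div_le_iff₀ hm]
    exact Nat.floor_le (by positivity)
  have hk2 : s ≤ gridTime (K * l) (k + 1) := by
    unfold gridTime
    rw [le_div_iff₀ hm]
    have := (Nat.lt_floor_add_one (s * ((K * l : ℕ) : ℝ≥0))).le
    rw [← hkdef] at this
    exact_mod_cast this
  have hk : k < T * (K * l) := by
    rw [hkdef, Nat.floor_lt (by positivity)]
    push_cast
    push_cast at hm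
    gcongr
  have hsub : Finset.Icc (-(L : ℤ)) x ⊆ Finset.Icc (-((L + 1 : ℕ) : ℤ)) x :=
    Finset.Icc_subset_Icc (by push_cast; omega) le_rfl
  rcases (hs k hk).eq_or_eq hn.mono hk1 hk2 with h | h
  · rw [windowState_of_forall_eq hn hk1 h,
      windowState_of_forall_eq hn hk1 fun y hy => h y (hsub hy)]
    exact hagree k hk x (hax _ (hdiv k hk))
  · rw [← windowState_of_forall_eq hn hk2 h,
      ← windowState_of_forall_eq hn hk2 fun y hy => h y (hsub hy)]
    exact hstep k hk (hagree k hk) x (hax _ (hdiv k hk))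

end Blocking

/-! ### Long runs of equal spins are unlikely -/

section Runs

variable {Ω : Type*} [MeasurableSpace Ω] {P : Measure Ω}
  {N : ℤ → ℝ≥0 → Ω → ℕ} {U : ℤ × ℕ → Ω → ℝ}

lemma ae_prod_of_ae_snd {p : unitInterval} {q : Ω → Prop} (h : ∀ᵐ ω ∂P, q ω) :
    ∀ᵐ z ∂((ber p).prod P), q z.2 :=
  Measure.quasiMeasurePreserving_snd.ae h

lemma ae_prod_of_ae_fst {p : unitInterval} {q : Config → Prop} (h : ∀ᵐ σ ∂(ber p), q σ) :
    ∀ᵐ z ∂((ber p).prod P), q z.1 :=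
  Measure.quasiMeasurePreserving_fst.ae h

variable [IsProbabilityMeasure P]

lemma measure_snd (p : unitInterval) (S : Set Ω) :
    (ber p).prod P {z | z.2 ∈ S} = P S := by
  have : {z : Config × Ω | z.2 ∈ S} = Set.univ ×ˢ S := by
    ext z
    simp
  rw [this, Measure.prod_prod, measure_univ, one_mul]

lemma IsNoise.measure_exists_not_simpleCell_le (h : IsNoise N U P) (a b : ℤ) (m M : ℕ) :
    P {ω | ∃ k < M, ¬ SimpleCell (fun x r => N x r ω) a b (gridTime m k) (gridTime m (k + 1))} ≤
      ENNReal.ofReal (M * (Finset.Icc a b).card ^ 2 * (1 / m) ^ 2) := by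
  have hsub : {ω | ∃ k < M, ¬ SimpleCell (fun x r => N x r ω) a b
      (gridTime m k) (gridTime m (k + 1))} ⊆ ⋃ k ∈ Finset.range M,
      {ω | ¬ SimpleCell (fun x r => N x r ω) a b (gridTime m k) (gridTime m (k + 1))} := by
    rintro ω ⟨k, hk, hω⟩
    exact Set.mem_biUnion (Finset.mem_coe.2 (Finset.mem_range.2 hk)) hω
  calc _ ≤ ∑ k ∈ Finset.range M, P {ω | ¬ SimpleCell (fun x r => N x r ω) a b
        (gridTime m k) (gridTime m (k + 1))} :=
        (measure_mono hsub).trans (measure_biUnion_finset_le _ _)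
    _ ≤ ∑ _k ∈ Finset.range M, ((Finset.Icc a b).card : ℝ≥0∞) ^ 2 * ENNReal.ofReal (1 / m) ^ 2 := by
        refine Finset.sum_le_sum fun k _ => ?_
        have := h.measure_not_simpleCell_le a b (gridTime_mono m (Nat.le_succ k))
        rw [gridTime_sub] at this
        refine this.trans (le_of_eq ?_)
        rw [← ENNReal.ofReal_coe_nnreal]
        push_cast
        rfl
    _ = _ := by
        rw [Finset.sum_const, Finset.card_range, nsmul_eq_mul, ENNReal.ofReal_mul (by positivity),
          ENNReal.ofReal_mul (by positivity), ENNReal.ofReal_pow (by positivity),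
          ENNReal.ofReal_pow (by positivity), ENNReal.ofReal_natCast, ENNReal.ofReal_natCast,
          mul_assoc]

open Classical in
/-- The probability that the cut-off dynamics in a window is in `A` at a grid time is at most a
multiple of the Bernoulli probability of `A`, up to the probability of two arrivals in a cell. -/
lemma IsNoise.measure_exists_mem_le (h : IsNoise N U P) {lam : ℝ} (h0 : 0 < lam) (h1 : lam < 1)
    {p : unitInterval} (hp0 : 0 < p) (hp1 : p < 1) {c : ℝ≥0}
    (hc : ∀ s, siteWt p s ≤ c * siteWt p (!s)) (L : ℕ) (R : ℤ) (m M : ℕ)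
    (A : Set (Finset.Icc (-(L : ℤ)) R → Bool)) :
    (ber p).prod P {z | ∃ k ≤ M, restr (-(L : ℤ)) R (windowState lam (fun x r => N x r z.2)
        (fun i => U i z.2) z.1 L R (gridTime m k)) ∈ A} ≤
      ENNReal.ofReal (M * (Finset.Icc (-(L : ℤ)) R).card ^ 2 * (1 / m) ^ 2) +
      ENNReal.ofReal (Real.exp (-(1 / m : ℝ))) ^ ((Finset.Icc (-(L : ℤ)) R).card * M) *
      ((1 + M * (ENNReal.ofReal (1 / m) * ((Finset.Icc (-(L : ℤ)) R).card + c))) *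
        (1 + ENNReal.ofReal (1 / m) * ((Finset.Icc (-(L : ℤ)) R).card + c)) ^ M *
        ∑ η, wt (siteWt p) η * (if η ∈ A then 1 else 0)) := by
  set Bad : Set (Config × Ω) := {z | z.2 ∈ {ω | ∃ k < M, ¬ SimpleCell (fun x r => N x r ω) (-(L : ℤ)) R
    (gridTime m k) (gridTime m (k + 1))}} with hBad
  -- the words along which the dynamics enters `A`
  set V : Set (Config × Ω) := ⋃ η : Finset.Icc (-(L : ℤ)) R → Bool, ⋃ w : Fin M → Option (Finset.Icc (-(L : ℤ)) R × Bool),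
    if η ∈ A ∨ Hits A (List.ofFn w) η then wordEvent N U lam m w η else ∅ with hV
  have hsub : {z : Config × Ω | ∃ k ≤ M, restr (-(L : ℤ)) R (windowState lam (fun x r => N x r z.2)
        (fun i => U i z.2) z.1 L R (gridTime m k)) ∈ A} ≤ᵐ[(ber p).prod P] (Bad ∪ V : Set _) := by
    filter_upwards [ae_prod_of_ae_snd h.ae_goodPaths, ae_prod_of_ae_snd (h.ae_ne lam),
      ae_prod_of_ae_fst (ae_rich hp0 hp1)] with z hz1 hz2 hz3
    rintro ⟨k, hk, hkA⟩
    by_cases hb : z ∈ Bad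
    · exact Or.inl hb
    right
    have hs : ∀ k < M, SimpleCell (fun x r => N x r z.2) (-(L : ℤ)) R (gridTime m k)
        (gridTime m (k + 1)) := by
      intro k hk
      by_contra hc
      exact hb ⟨k, hk, hc⟩
    obtain ⟨w, hw1, hw2, hw3⟩ := exists_word hz1 hz2 hz3 hs
    have hor := mem_or_hits A w (fun k => restr (-(L : ℤ)) R (windowState lam (fun x r => N x r z.2)
        (fun i => U i z.2) z.1 L R (gridTime m k))) hw3 hk hkA
    have hzero : gridTime m 0 = 0 := by simp [gridTime]
    rw [hzero, windowState_zero] at hor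
    rw [hV, Set.mem_iUnion]
    refine ⟨restr (-(L : ℤ)) R z.1, Set.mem_iUnion.2 ⟨w, ?_⟩⟩
    rw [if_pos hor]
    refine ⟨rfl, ?_, ?_⟩
    · simp only [Set.mem_iInter]
      exact fun x hx k hk => hw1 x hx k (Finset.mem_range.1 hk)
    · simp only [Set.mem_iInter]
      exact fun k _ => hw2 k
  refine (measure_mono_ae hsub).trans ((measure_union_le _ _).trans (add_le_add ?_ ?_))
  · rw [hBad, measure_snd]
    exact h.measure_exists_not_simpleCell_le (-(L : ℤ)) R m M
  · have hcard : ((Finset.Icc (-(L : ℤ)) R).card : ℝ≥0∞) =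
        (Fintype.card (Finset.Icc (-(L : ℤ)) R) : ℝ≥0∞) := by rw [Fintype.card_coe]
    calc (ber p).prod P V ≤ ∑ η : Finset.Icc (-(L : ℤ)) R → Bool, ∑ w : Fin M → Option (Finset.Icc (-(L : ℤ)) R × Bool),
          (ber p).prod P (if η ∈ A ∨ Hits A (List.ofFn w) η then wordEvent N U lam m w η else ∅) := by
          refine (measure_iUnion_fintype_le _ _).trans (Finset.sum_le_sum fun η _ => ?_)
          exact measure_iUnion_fintype_le _ _
      _ = ENNReal.ofReal (Real.exp (-(1 / m : ℝ))) ^ ((Finset.Icc (-(L : ℤ)) R).card * M) *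
          ∑ η : Finset.Icc (-(L : ℤ)) R → Bool, ∑ w : Fin M → Option (Finset.Icc (-(L : ℤ)) R × Bool),
          (if η ∈ A ∨ Hits A (List.ofFn w) η then
            wt (siteWt p) η * ∏ i, letterWt (ENNReal.ofReal (1 / m)) (rate lam) (w i) else 0) := by
          rw [Finset.mul_sum]
          refine Finset.sum_congr rfl fun η _ => ?_
          rw [Finset.mul_sum]
          refine Finset.sum_congr rfl fun w _ => ?_
          split_ifs
          · rw [h.measure_wordEvent h0 h1]
          · simp
      _ ≤ _ := by
          rw [hcard]
          exact mul_le_mul' le_rfl (sum_wt_mem_or_hits_le hc (rate_add h0 h1) A M)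

/-- The window configurations with `K + 1` consecutive equal spins. -/
def runSet (K : ℕ) (a b : ℤ) : Set (Finset.Icc a b → Bool) :=
  {η | ∃ s y, a ≤ y ∧ y + K ≤ b ∧ ∀ z : Finset.Icc a b, y ≤ z → z ≤ y + K → η z = s}

open Classical in
lemma sum_wt_run_le {p : unitInterval} {r : ℝ≥0} (hr : ∀ s, siteWt p s ≤ r) (K : ℕ) (a b : ℤ) :
    ∑ η : Finset.Icc a b → Bool, wt (siteWt p) η * (if η ∈ runSet K a b then 1 else 0) ≤
      2 * (Finset.Icc a b).card * (r : ℝ≥0∞) ^ (K + 1) := by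
  set W := Finset.Icc a b
  set B : ℤ → Finset W := fun y => (Finset.Icc y (y + K)).subtype (· ∈ W) with hB
  set Y := W.filter fun y => y + K ≤ b with hY
  have hcard : ∀ y ∈ Y, (B y).card = K + 1 := by
    intro y hy
    rw [hY, Finset.mem_filter, Finset.mem_Icc] at hy
    rw [hB, Finset.card_subtype, Finset.filter_true_of_mem, Int.card_Icc]
    · omega
    · intro z hz
      rw [Finset.mem_Icc] at hz ⊢
      omega
  have hpt : ∀ η : W → Bool, wt (siteWt p) η * (if η ∈ runSet K a b then 1 else 0) ≤
      ∑ y ∈ Y, ∑ s, wt (siteWt p) η * (if ∀ i ∈ B y, η i = s then 1 else 0) := by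
    intro η
    split_ifs with hη
    · obtain ⟨s, y, hy1, hy2, hy3⟩ := hη
      have hyY : y ∈ Y := by
        rw [hY, Finset.mem_filter, Finset.mem_Icc]
        omega
      have hconst : ∀ i ∈ B y, η i = s := by
        intro i hi
        rw [hB, Finset.mem_subtype, Finset.mem_Icc] at hi
        exact hy3 i hi.1 hi.2
      refine le_trans ?_ (Finset.single_le_sum (fun _ _ => zero_le) hyY)
      refine le_trans ?_ (Finset.single_le_sum (fun _ _ => zero_le) (Finset.mem_univ s))
      rw [if_pos hconst]
    · simp
  calc _ ≤ ∑ η : W → Bool, ∑ y ∈ Y, ∑ s,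
        wt (siteWt p) η * (if ∀ i ∈ B y, η i = s then 1 else 0) :=
        Finset.sum_le_sum fun η _ => hpt η
    _ = ∑ y ∈ Y, ∑ s, siteWt p s ^ (B y).card := by
        rw [Finset.sum_comm]
        refine Finset.sum_congr rfl fun y _ => ?_
        rw [Finset.sum_comm]
        exact Finset.sum_congr rfl fun s _ => sum_wt_const (siteWt_add p) (B y) s
    _ ≤ ∑ _y ∈ Y, 2 * (r : ℝ≥0∞) ^ (K + 1) := by
        refine Finset.sum_le_sum fun y hy => ?_
        rw [hcard y hy, Fintype.sum_bool, two_mul]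
        exact add_le_add (pow_le_pow_left' (hr _) _) (pow_le_pow_left' (hr _) _)
    _ ≤ ∑ _y ∈ W, 2 * (r : ℝ≥0∞) ^ (K + 1) :=
        Finset.sum_le_sum_of_subset (Finset.filter_subset _ _)
    _ = _ := by
        rw [Finset.sum_const, nsmul_eq_mul]
        ring

lemma hasRun_iff_restr {K : ℕ} {a b : ℤ} {η : Config} :
    HasRun K a b η ↔ restr a b η ∈ runSet K a b := by
  constructor
  · rintro ⟨s, y, h1, h2, h3⟩
    exact ⟨s, y, h1, h2, fun z => h3 z⟩
  · rintro ⟨s, y, h1, h2, h3⟩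
    exact ⟨s, y, h1, h2, fun z hz hz' =>
      h3 ⟨z, Finset.mem_Icc.2 ⟨by omega, by omega⟩⟩ hz hz'⟩

/-- The probability that the cut-off dynamics in `[-L, R]` has a run of `K + 1` equal spins
at a grid time up to `T`. -/
lemma IsNoise.measure_exists_hasRun_le (h : IsNoise N U P) {lam : ℝ} (h0 : 0 < lam) (h1 : lam < 1)
    {p : unitInterval} (hp0 : 0 < p) (hp1 : p < 1) {c r : ℝ≥0}
    (hc : ∀ s, siteWt p s ≤ c * siteWt p (!s)) (hr : ∀ s, siteWt p s ≤ r) (L : ℕ) (R : ℤ)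
    (K T : ℕ) {m : ℕ} (hm : 0 < m) :
    (ber p).prod P {z | ∃ k ≤ T * m, HasRun K (-(L : ℤ)) R (windowState lam
        (fun x r => N x r z.2) (fun i => U i z.2) z.1 L R (gridTime m k))} ≤
      ENNReal.ofReal (T * (Finset.Icc (-(L : ℤ)) R).card ^ 2 * (1 / m)) +
      ENNReal.ofReal ((1 + T * ((Finset.Icc (-(L : ℤ)) R).card + c)) * Real.exp (c * T) *
        (2 * (Finset.Icc (-(L : ℤ)) R).card * (r : ℝ) ^ (K + 1))) := by
  classical
  have hm' : (0 : ℝ) < m := by exact_mod_cast hm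
  simp only [hasRun_iff_restr]
  refine (h.measure_exists_mem_le h0 h1 hp0 hp1 hc L R m (T * m) _).trans ?_
  set v := (Finset.Icc (-(L : ℤ)) R).card
  refine add_le_add (le_of_eq ?_) ?_
  · congr 1
    push_cast
    field_simp
  · refine (mul_le_mul' le_rfl (mul_le_mul' le_rfl (sum_wt_run_le hr K (-(L : ℤ)) R))).trans ?_
    have hcv : ((v : ℝ≥0∞) + c) = ENNReal.ofReal (v + c) := by
      rw [ENNReal.ofReal_add (by positivity) (by positivity), ENNReal.ofReal_natCast,
        ENNReal.ofReal_coe_nnreal]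
    have hrK : 2 * (v : ℝ≥0∞) * (r : ℝ≥0∞) ^ (K + 1) =
        ENNReal.ofReal (2 * v * (r : ℝ) ^ (K + 1)) := by
      rw [ENNReal.ofReal_mul (by positivity), ENNReal.ofReal_mul (by positivity),
        ENNReal.ofReal_pow (by positivity), ENNReal.ofReal_natCast, ENNReal.ofReal_coe_nnreal,
        ENNReal.ofReal_ofNat]
    have hone : (1 : ℝ≥0∞) = ENNReal.ofReal 1 := by simp
    rw [hcv, hrK, hone, ← ENNReal.ofReal_natCast (T * m), ← ENNReal.ofReal_pow (by positivity),
      ← ENNReal.ofReal_mul (by positivity), ← ENNReal.ofReal_mul (by positivity),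
      ← ENNReal.ofReal_add (by positivity) (by positivity),
      ← ENNReal.ofReal_add (by positivity) (by positivity),
      ← ENNReal.ofReal_pow (by positivity), ← ENNReal.ofReal_mul (by positivity),
      ← ENNReal.ofReal_mul (by positivity), ← ENNReal.ofReal_mul (by positivity)]
    refine ENNReal.ofReal_le_ofReal ?_
    have e1 : ((T * m : ℕ) : ℝ) * (1 / m * (v + c)) = T * (v + c) := by
      push_cast
      field_simp
    have e2 : (1 + 1 / (m : ℝ) * (v + c)) ^ (T * m) ≤ Real.exp (T * (v + c)) := by
      calc _ ≤ (Real.exp (1 / (m : ℝ) * (v + c))) ^ (T * m) := by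
            gcongr
            rw [add_comm]
            exact Real.add_one_le_exp _
        _ = _ := by
            rw [← Real.exp_nat_mul, e1]
    have e3 : Real.exp (-(1 / (m : ℝ))) ^ (v * (T * m)) = Real.exp (-(T * v)) := by
      rw [← Real.exp_nat_mul]
      congr 1
      push_cast
      field_simp
    rw [e1, e3]
    calc Real.exp (-(T * v)) * ((1 + T * (v + c)) * (1 + 1 / (m : ℝ) * (v + c)) ^ (T * m) *
          (2 * v * (r : ℝ) ^ (K + 1)))
        ≤ Real.exp (-(T * v)) * ((1 + T * (v + c)) * Real.exp (T * (v + c)) *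
          (2 * v * (r : ℝ) ^ (K + 1))) := by gcongr
      _ = (1 + T * (v + c)) * (Real.exp (-(T * v)) * Real.exp (T * (v + c))) *
          (2 * v * (r : ℝ) ^ (K + 1)) := by ring
      _ = _ := by
          rw [← Real.exp_add]
          congr 3
          ring

end Runs

/-! ### Stabilization of the cut-off dynamics -/

section Stabilization

variable {Ω : Type*} [MeasurableSpace Ω] {P : Measure Ω} [IsProbabilityMeasure P]
  {N : ℤ → ℝ≥0 → Ω → ℕ} {U : ℤ × ℕ → Ω → ℝ}

/-- The probability that each of `q` successive strips of `K` sites has an arrival. -/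
lemma IsNoise.measure_no_free_strip_le (h : IsNoise N U P) (K q : ℕ) (a : ℤ) {s t : ℝ≥0}
    (hst : s ≤ t) :
    P {ω | ∀ j < q, ∃ y ∈ Finset.Ico (a + j * K) (a + j * K + K), N y t ω ≠ N y s ω} ≤
      ENNReal.ofReal (1 - Real.exp (-(t - s : ℝ≥0)) ^ K) ^ q := by
  set I : ℤ → Ω → ℕ := fun x ω => N x t ω - N x s ω with hI
  set S : ℕ → Finset ℤ := fun j => Finset.Ico (a + j * K) (a + j * K + K) with hS
  have hm : Measurable fun f : ℝ≥0 → ℕ => f t - f s :=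
    (measurable_pi_apply t).sub (measurable_pi_apply s)
  have hInd : iIndepFun I P := h.indep_N.comp (fun _ f => f t - f s) fun _ => hm
  have hdisj : Set.PairwiseDisjoint Set.univ S := by
    have key : ∀ i j : ℕ, i < j → Disjoint (S i) (S j) := by
      intro i j hij
      rw [Finset.disjoint_left]
      intro y hy hy'
      rw [hS, Finset.mem_Ico] at hy hy'
      have h1 : ((i : ℤ) + 1) * K ≤ j * K := by
        have : (i : ℤ) + 1 ≤ j := by exact_mod_cast hij
        gcongr
      linarith [hy.2, hy'.1]
    intro i _ j _ hij
    rcases lt_or_gt_of_ne hij with hlt | hlt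
    · exact key i j hlt
    · exact (key j i hlt).symm
  have hmeas : ∀ x, Measurable (I x) := fun x => h.measurable_inc x s t
  -- the event that the strip `j` is hit, as an event for the increments at the sites of a set `T`
  set A : (T : Finset ℤ) → ℕ → Set (T → ℕ) := fun T j => {f | ∃ i : T, (i : ℤ) ∈ S j ∧ f i ≠ 0}
    with hA
  have hone : ∀ j, P ((fun ω (i : S j) => I i ω) ⁻¹' A (S j) j) =
      ENNReal.ofReal (1 - Real.exp (-(t - s : ℝ≥0)) ^ K) := by
    intro j
    have e : (fun ω (i : S j) => I i ω) ⁻¹' A (S j) j = (⋂ i ∈ S j, I i ⁻¹' {0})ᶜ := by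
      ext ω
      simp only [hA, Set.mem_preimage, Set.mem_ofPred_eq, Set.mem_compl_iff, Set.mem_iInter,
        Set.mem_singleton_iff]
      push Not
      exact ⟨fun ⟨i, hi, hi'⟩ => ⟨i, hi, hi'⟩, fun ⟨i, hi, hi'⟩ => ⟨⟨i, hi⟩, hi, hi'⟩⟩
    have e2 : ∀ x, P (I x ⁻¹' {0}) = ENNReal.ofReal (Real.exp (-(t - s : ℝ≥0))) := by
      intro x
      rw [h.measure_inc_eq x hst 0]
      simp
    rw [e, prob_compl_eq_one_sub (Finset.measurableSet_biInter _ fun i _ =>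
      hmeas i (measurableSet_singleton 0)), hInd.measure_inter_preimage_eq_mul (S j)
      (sets := fun _ => {0}) fun _ _ => measurableSet_singleton 0]
    simp_rw [e2]
    rw [Finset.prod_const, hS, Int.card_Ico, add_sub_cancel_left, Int.toNat_natCast,
      ← ENNReal.ofReal_pow (by positivity), ENNReal.ofReal_sub _ (by positivity),
      ENNReal.ofReal_one]
  have hall : ∀ q : ℕ, P {ω | ∀ j < q, ∃ y ∈ S j, I y ω ≠ 0} =
      ENNReal.ofReal (1 - Real.exp (-(t - s : ℝ≥0)) ^ K) ^ q := by
    intro q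
    induction q with
    | zero => simp
    | succ q ih =>
      set T := (Finset.range q).biUnion S with hT
      have hTS : Disjoint T (S q) := by
        rw [hT, Finset.disjoint_biUnion_left]
        intro j hj
        exact hdisj (Set.mem_univ _) (Set.mem_univ _) (Finset.mem_range.1 hj).ne
      have hind := hInd.indepFun_finset T (S q) hTS hmeas
      have e1 : (fun ω (i : T) => I i ω) ⁻¹' (⋂ j ∈ Finset.range q, A T j) =
          {ω | ∀ j < q, ∃ y ∈ S j, I y ω ≠ 0} := by
        ext ω
        simp only [hA, Set.mem_preimage, Set.mem_iInter, Finset.mem_range, Set.mem_ofPred_eq]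
        refine forall₂_congr fun j hj => ?_
        exact ⟨fun ⟨i, hi, hi'⟩ => ⟨i, hi, hi'⟩, fun ⟨i, hi, hi'⟩ =>
          ⟨⟨i, Finset.mem_biUnion.2 ⟨j, Finset.mem_range.2 hj, hi⟩⟩, hi, hi'⟩⟩
      have e2 : {ω | ∀ j < q + 1, ∃ y ∈ S j, I y ω ≠ 0} =
          (fun ω (i : T) => I i ω) ⁻¹' (⋂ j ∈ Finset.range q, A T j) ∩
          (fun ω (i : S q) => I i ω) ⁻¹' A (S q) q := by
        rw [e1]
        ext ω
        simp only [hA, Set.mem_inter_iff, Set.mem_preimage, Set.mem_ofPred_eq]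
        constructor
        · intro hω
          obtain ⟨y, hy, hy'⟩ := hω q (Nat.lt_succ_self q)
          exact ⟨fun j hj => hω j (hj.trans (Nat.lt_succ_self q)), ⟨y, hy⟩, hy, hy'⟩
        · rintro ⟨h1, ⟨y, hy⟩, -, hy'⟩ j hj
          rcases (Nat.lt_succ_iff.1 hj).lt_or_eq with hlt | rfl
          · exact h1 j hlt
          · exact ⟨y, hy, hy'⟩
      rw [e2, hind.measure_inter_preimage_eq_mul _ _ (Set.to_countable _).measurableSet
        (Set.to_countable _).measurableSet, e1, ih, hone, pow_succ]
  rw [← hall q]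
  refine measure_mono_ae ?_
  filter_upwards [h.ae_goodPaths] with ω hω hq j hj
  obtain ⟨y, hy, hne⟩ := hq j hj
  refine ⟨y, hy, ?_⟩
  have h2 : N y s ω ≤ N y t ω := hω.mono y hst
  show N y t ω - N y s ω ≠ 0
  omega

/-- The probability that the activity of the site `-(L + 1)` has an influence on the spin at `x`
before time `T`. -/
lemma IsNoise.measure_windowState_ne_le (h : IsNoise N U P) {lam : ℝ} (h0 : 0 < lam)
    (h1 : lam < 1) {p : unitInterval} (hp0 : 0 < p) (hp1 : p < 1) {c r : ℝ≥0}
    (hc : ∀ s, siteWt p s ≤ c * siteWt p (!s)) (hr : ∀ s, siteWt p s ≤ r) {L : ℕ} {x : ℤ}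
    {K T : ℕ} (hK : 0 < K) (hx : -(L : ℤ) + T * K ^ 3 ≤ x) {v : ℝ}
    (hv : ((Finset.Icc (-((L + 1 : ℕ) : ℤ)) x).card : ℝ) ≤ v) :
    (ber p).prod P {z | ∃ s < (T : ℝ≥0), windowState lam (fun x r => N x r z.2)
        (fun i => U i z.2) z.1 L x s x ≠ windowState lam (fun x r => N x r z.2)
        (fun i => U i z.2) z.1 (L + 1) x s x} ≤
      ENNReal.ofReal (2 * ((1 + T * (v + c)) * Real.exp (c * T) * (2 * v * (r : ℝ) ^ (K + 1))) +
        T * K * (1 - Real.exp (-1)) ^ K) := by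
  set Q := (ber p).prod P
  set F : Set (Config × Ω) := {z | ∃ s < (T : ℝ≥0), windowState lam (fun x r => N x r z.2)
        (fun i => U i z.2) z.1 L x s x ≠ windowState lam (fun x r => N x r z.2)
        (fun i => U i z.2) z.1 (L + 1) x s x} with hF
  set v1 := (Finset.Icc (-((L + 1 : ℕ) : ℤ)) x).card with hv1
  set v0 := (Finset.Icc (-(L : ℤ)) x).card with hv0
  have hv01 : v0 ≤ v1 :=
    Finset.card_le_card (Finset.Icc_subset_Icc (by push_cast; omega) le_rfl)
  have hv0' : (v0 : ℝ) ≤ v := le_trans (by exact_mod_cast hv01) hv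
  have hvnn : 0 ≤ v := le_trans (by positivity) hv
  set B := (1 + T * (v + c)) * Real.exp (c * T) * (2 * v * (r : ℝ) ^ (K + 1)) with hB
  -- no strip of the `i`-th region is free during the `i`-th time interval
  set Fr : ℕ → Set (Config × Ω) := fun i => {z | z.2 ∈ {ω | ∀ j < K,
    ∃ y ∈ Finset.Ico (-(L : ℤ) + i * K ^ 2 + j * K) (-(L : ℤ) + i * K ^ 2 + j * K + K),
      N y (gridTime K (i + 1)) ω ≠ N y (gridTime K i) ω}} with hFr
  have hexp1 : Real.exp (-1) ≤ 1 := Real.exp_le_one_iff.2 (by norm_num)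
  have hFrle : ∀ i, Q (Fr i) ≤ ENNReal.ofReal ((1 - Real.exp (-1)) ^ K) := by
    intro i
    rw [hFr, measure_snd]
    refine (h.measure_no_free_strip_le K K _ (gridTime_mono K (Nat.le_succ i))).trans ?_
    rw [gridTime_sub, ← Real.exp_nat_mul, ← ENNReal.ofReal_pow]
    · refine le_of_eq ?_
      congr 4
      have : (K : ℝ) ≠ 0 := by exact_mod_cast hK.ne'
      push_cast
      field_simp
    · rw [sub_nonneg, Real.exp_le_one_iff]
      have : (0 : ℝ) ≤ ((1 / K : ℝ≥0) : ℝ) := NNReal.coe_nonneg _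
      nlinarith [Nat.cast_nonneg (α := ℝ) K]
  -- the bound for the mesh `1 / (K * l)`; the first term vanishes as `l` tends to infinity
  have main : ∀ l : ℕ, 0 < l → Q F ≤ ENNReal.ofReal (3 * (T * v ^ 2 * (1 / (K * l : ℕ)))) +
      ENNReal.ofReal (2 * B + T * K * (1 - Real.exp (-1)) ^ K) := by
    intro l hl
    set m := K * l with hm
    have hmpos : 0 < m := Nat.mul_pos hK hl
    have hm' : (0 : ℝ) < m := by exact_mod_cast hmpos
    -- two arrivals in a cell, or a long run in one of the two dynamics
    set E1 : Set (Config × Ω) := {z | z.2 ∈ {ω | ∃ k < T * m, ¬ SimpleCell (fun x r => N x r ω)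
      (-((L + 1 : ℕ) : ℤ)) x (gridTime m k) (gridTime m (k + 1))}} with hE1
    set E2 : Set (Config × Ω) := {z | ∃ k ≤ T * m, HasRun K (-(L : ℤ)) x (windowState lam
        (fun x r => N x r z.2) (fun i => U i z.2) z.1 L x (gridTime m k))} with hE2
    set E3 : Set (Config × Ω) := {z | ∃ k ≤ T * m, HasRun K (-((L + 1 : ℕ) : ℤ)) x
      (windowState lam (fun x r => N x r z.2) (fun i => U i z.2) z.1 (L + 1) x (gridTime m k))}
      with hE3
    have hsub : F ≤ᵐ[Q] (E1 ∪ (E2 ∪ (E3 ∪ ⋃ i ∈ Finset.range (T * K), Fr i)) : Set _) := by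
      filter_upwards [ae_prod_of_ae_snd (p := p) h.ae_goodPaths] with z hz
      rintro ⟨s, hsT, hne⟩
      by_contra hcon
      refine hne ?_
      have hcon1 : z ∉ E1 := fun hc => hcon (Or.inl hc)
      have hcon2 : z ∉ E2 := fun hc => hcon (Or.inr (Or.inl hc))
      have hcon3 : z ∉ E3 := fun hc => hcon (Or.inr (Or.inr (Or.inl hc)))
      have hcon4 : ∀ i < T * K, z ∉ Fr i := fun i hi hc => hcon (Or.inr (Or.inr (Or.inr
        (Set.mem_biUnion (Finset.mem_coe.2 (Finset.mem_range.2 hi)) hc))))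
      have hex : ∀ i, ∃ j : ℕ, i < T * K → j < K ∧
          ∀ y ∈ Finset.Ico (-(L : ℤ) + i * K ^ 2 + j * K) (-(L : ℤ) + i * K ^ 2 + j * K + K),
            N y (gridTime K (i + 1)) z.2 = N y (gridTime K i) z.2 := by
        intro i
        by_cases hi : i < T * K
        · have := hcon4 i hi
          simp only [hFr, Set.mem_ofPred_eq] at this
          push Not at this
          obtain ⟨j, hj, hj'⟩ := this
          exact ⟨j, fun _ => ⟨hj, hj'⟩⟩
        · exact ⟨0, fun hc => absurd hc hi⟩
      choose j hj using hex
      refine agree_of_strips hz hK hl (fun k hk => ?_) (fun k hk hc => hcon2 ⟨k, hk, hc⟩)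
        (fun k hk hc => hcon3 ⟨k, hk, hc⟩) (fun i => -(L : ℤ) + i * K ^ 2 + j i * K)
        (fun i hi => ?_) hx hsT
      · by_contra hc
        exact hcon1 ⟨k, hk, hc⟩
      · obtain ⟨hjK, hj'⟩ := hj i hi
        refine ⟨le_add_of_nonneg_right (by positivity), ?_, hj'⟩
        have : ((j i : ℤ) + 1) * K ≤ K * K := by
          have : (j i : ℤ) + 1 ≤ K := by exact_mod_cast hjK
          gcongr
        linarith
    have b1 : Q E1 ≤ ENNReal.ofReal (T * v ^ 2 * (1 / m)) := by
      rw [hE1, measure_snd]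
      refine (h.measure_exists_not_simpleCell_le _ _ m (T * m)).trans
        (ENNReal.ofReal_le_ofReal ?_)
      calc ((T * m : ℕ) : ℝ) * v1 ^ 2 * (1 / m) ^ 2 = T * v1 ^ 2 * (1 / m) := by
            push_cast
            field_simp
        _ ≤ _ := by gcongr
    have b2 : Q E2 ≤ ENNReal.ofReal (T * v ^ 2 * (1 / m)) + ENNReal.ofReal B := by
      refine (h.measure_exists_hasRun_le h0 h1 hp0 hp1 hc hr L x K T hmpos).trans ?_
      rw [hB]
      gcongr
    have b3 : Q E3 ≤ ENNReal.ofReal (T * v ^ 2 * (1 / m)) + ENNReal.ofReal B := by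
      refine (h.measure_exists_hasRun_le h0 h1 hp0 hp1 hc hr (L + 1) x K T hmpos).trans ?_
      rw [hB]
      gcongr
    have b4 : Q (⋃ i ∈ Finset.range (T * K), Fr i) ≤
        ENNReal.ofReal (T * K * (1 - Real.exp (-1)) ^ K) := by
      refine (measure_biUnion_finset_le _ _).trans ?_
      refine (Finset.sum_le_sum fun i _ => hFrle i).trans (le_of_eq ?_)
      rw [Finset.sum_const, Finset.card_range, nsmul_eq_mul, ENNReal.ofReal_mul (by positivity)]
      congr 1
      rw [← Nat.cast_mul, ENNReal.ofReal_natCast]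
    have hBnn : 0 ≤ B := by positivity
    have hTK : 0 ≤ T * K * (1 - Real.exp (-1)) ^ K :=
      mul_nonneg (by positivity) (pow_nonneg (by linarith) _)
    have hTv : 0 ≤ T * v ^ 2 * (1 / (m : ℝ)) := by positivity
    refine (measure_mono_ae hsub).trans ((measure_union_le _ _).trans
      ((add_le_add b1 ((measure_union_le _ _).trans (add_le_add b2
        ((measure_union_le _ _).trans (add_le_add b3 b4))))).trans (le_of_eq ?_)))
    rw [← ENNReal.ofReal_add hTv hBnn, ← ENNReal.ofReal_add (by positivity) hTK,
      ← ENNReal.ofReal_add (by positivity) (by positivity),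
      ← ENNReal.ofReal_add (by positivity) (by positivity),
      ← ENNReal.ofReal_add (by positivity) (by positivity)]
    congr 1
    ring
  have hlim : Tendsto (fun l : ℕ => ENNReal.ofReal (3 * (T * v ^ 2 * (1 / (K * l : ℕ)))) +
      ENNReal.ofReal (2 * B + T * K * (1 - Real.exp (-1)) ^ K)) atTop
      (𝓝 (0 + ENNReal.ofReal (2 * B + T * K * (1 - Real.exp (-1)) ^ K))) := by
    refine Tendsto.add ?_ tendsto_const_nhds
    rw [← ENNReal.ofReal_zero]
    refine ENNReal.tendsto_ofReal ?_
    have h1 : Tendsto (fun l : ℕ => (1 : ℝ) / l) atTop (𝓝 0) := tendsto_one_div_atTop_nhds_zero_nat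
    have h2 := (h1.comp (tendsto_id.const_mul_atTop' hK)).const_mul (3 * (T * v ^ 2))
    rw [mul_zero] at h2
    refine h2.congr fun l => ?_
    simp only [Function.comp_apply, id]
    ring
  rw [zero_add] at hlim
  refine ge_of_tendsto hlim ?_
  filter_upwards [eventually_gt_atTop 0] with l hl
  exact main l hl

end Stabilization

section Limit

variable {Ω : Type*} [MeasurableSpace Ω] {P : Measure Ω} [IsProbabilityMeasure P]
  {N : ℤ → ℝ≥0 → Ω → ℕ} {U : ℤ × ℕ → Ω → ℝ}

lemma one_sub_exp_neg_one_mem : 0 < 1 - Real.exp (-1) ∧ 1 - Real.exp (-1) < 1 := by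
  have h1 : Real.exp (-1) < 1 := Real.exp_lt_one_iff.2 (by norm_num)
  have h2 := Real.exp_pos (-1)
  constructor <;> linarith

/-- Almost surely, for each site, the cut-off paths at this site up to a given time coincide for
all sufficiently large cut-offs. By the Borel-Cantelli lemma, applied to the cut-offs between
`T K ^ 3 + |x|` and `T (K + 1) ^ 3 + |x|`, `K = 1, 2, …`. -/
theorem IsNoise.ae_eventually_cutoff_eq (h : IsNoise N U P) {lam : ℝ} (h0 : 0 < lam)
    (h1 : lam < 1) {p : unitInterval} (hp0 : 0 < p) (hp1 : p < 1) (x : ℤ) {T : ℕ} (hT : 0 < T) :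
    ∀ᵐ z ∂((ber p).prod P), ∃ L₀ : ℕ, ∀ L, L₀ ≤ L → ∀ s < (T : ℝ≥0),
      cutoff lam (fun x r => N x r z.2) (fun i => U i z.2) z.1 L s x =
      cutoff lam (fun x r => N x r z.2) (fun i => U i z.2) z.1 (L + 1) s x := by
  obtain ⟨c, hc⟩ := exists_siteWt_le_mul hp0 hp1
  obtain ⟨r, hr1, hr⟩ := exists_siteWt_le hp0 hp1
  set Q := (ber p).prod P
  set f : ℕ → ℕ := fun K => T * K ^ 3 + x.natAbs with hf
  set F : ℕ → Set (Config × Ω) := fun L => {z | ∃ s < (T : ℝ≥0),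
    windowState lam (fun x r => N x r z.2) (fun i => U i z.2) z.1 L x s x ≠
      windowState lam (fun x r => N x r z.2) (fun i => U i z.2) z.1 (L + 1) x s x} with hF
  -- a common ratio for the probabilities of long runs and of the absence of free strips
  set ρ : ℝ := max r (1 - Real.exp (-1)) with hρ
  obtain ⟨he0, he1⟩ := one_sub_exp_neg_one_mem
  have hρ0 : 0 < ρ := lt_max_of_lt_right he0
  have hρ1 : ρ < 1 := max_lt (by exact_mod_cast hr1) he1
  set C₁ : ℝ := T + 2 * x.natAbs + 2 with hC₁
  set C : ℝ := C₁ * (4 * (1 + T * C₁ + T * c) * Real.exp (c * T) * C₁ + T) with hC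
  have hC₁0 : 0 ≤ C₁ := by positivity
  have hbound : ∀ K : ℕ, 0 < K →
      Q (⋃ L ∈ Finset.Ico (f K) (f (K + 1)), F L) ≤
        ENNReal.ofReal (C * ((K + 1 : ℝ) ^ 9 * ρ ^ K)) := by
    intro K hK
    set B : ℝ := (K + 1 : ℝ) ^ 3 with hB
    have hKB : (1 : ℝ) ≤ K + 1 := by
      have : (0 : ℝ) ≤ K := by positivity
      linarith
    have hB1 : 1 ≤ B := one_le_pow₀ hKB
    have hfB : (f (K + 1) : ℝ) ≤ C₁ * B := by
      rw [hf, hC₁]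
      push_cast
      have hx0 : (0 : ℝ) ≤ x.natAbs := by positivity
      nlinarith
    have hFL : ∀ L ∈ Finset.Ico (f K) (f (K + 1)), Q (F L) ≤ ENNReal.ofReal
        (2 * ((1 + T * (C₁ * B + c)) * Real.exp (c * T) * (2 * (C₁ * B) * (r : ℝ) ^ (K + 1))) +
        T * K * (1 - Real.exp (-1)) ^ K) := by
      intro L hL
      rw [Finset.mem_Ico, hf] at hL
      refine h.measure_windowState_ne_le h0 h1 hp0 hp1 hc hr hK ?_ ?_
      · have : ((T * K ^ 3 + x.natAbs : ℕ) : ℤ) ≤ L := by exact_mod_cast hL.1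
        push_cast at this
        have h2 := neg_abs_le x
        linarith
      · rw [Int.card_Icc]
        have e : ((x + 1 - -((L + 1 : ℕ) : ℤ)).toNat : ℤ) ≤ f (K + 1) + x.natAbs + 1 := by
          have : (L : ℤ) + 1 ≤ f (K + 1) := by exact_mod_cast hL.2
          have := Int.le_natAbs (a := x)
          omega
        have e' : ((x + 1 - -((L + 1 : ℕ) : ℤ)).toNat : ℝ) ≤ f (K + 1) + x.natAbs + 1 := by
          exact_mod_cast e
        refine e'.trans ?_
        rw [hf, hC₁]
        push_cast
        have hx0 : (0 : ℝ) ≤ x.natAbs := by positivity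
        nlinarith
    calc Q (⋃ L ∈ Finset.Ico (f K) (f (K + 1)), F L)
        ≤ ∑ L ∈ Finset.Ico (f K) (f (K + 1)), Q (F L) := measure_biUnion_finset_le _ _
      _ ≤ ∑ _L ∈ Finset.Ico (f K) (f (K + 1)), ENNReal.ofReal
          (2 * ((1 + T * (C₁ * B + c)) * Real.exp (c * T) * (2 * (C₁ * B) * (r : ℝ) ^ (K + 1))) +
          T * K * (1 - Real.exp (-1)) ^ K) := Finset.sum_le_sum hFL
      _ ≤ (f (K + 1) : ℕ) * ENNReal.ofReal
          (2 * ((1 + T * (C₁ * B + c)) * Real.exp (c * T) * (2 * (C₁ * B) * (r : ℝ) ^ (K + 1))) +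
          T * K * (1 - Real.exp (-1)) ^ K) := by
          rw [Finset.sum_const, Nat.card_Ico, nsmul_eq_mul]
          gcongr
          exact Nat.sub_le _ _
      _ ≤ ENNReal.ofReal (C * ((K + 1 : ℝ) ^ 9 * ρ ^ K)) := by
          rw [← ENNReal.ofReal_natCast, ← ENNReal.ofReal_mul (by positivity)]
          refine ENNReal.ofReal_le_ofReal ?_
          have hrρ : (r : ℝ) ^ (K + 1) ≤ ρ ^ K := by
            calc (r : ℝ) ^ (K + 1) ≤ (r : ℝ) ^ K :=
                  pow_le_pow_of_le_one r.2 (by exact_mod_cast hr1.le) (Nat.le_succ K)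
              _ ≤ ρ ^ K := pow_le_pow_left₀ r.2 (le_max_left _ _) K
          have heρ : (1 - Real.exp (-1)) ^ K ≤ ρ ^ K :=
            pow_le_pow_left₀ he0.le (le_max_right _ _) K
          have hlin : 1 + T * (C₁ * B + c) ≤ (1 + T * C₁ + T * c) * B := by
            have : (0 : ℝ) ≤ T * c := by positivity
            nlinarith
          have hKB2 : (T : ℝ) * K ≤ T * (B * B) := by
            have : (K : ℝ) ≤ B := by
              calc (K : ℝ) ≤ K + 1 := by linarith
                _ ≤ B := le_self_pow₀ hKB (by norm_num)
            have : (K : ℝ) ≤ B * B := by nlinarith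
            gcongr
          have hB9 : (K + 1 : ℝ) ^ 9 = B * (B * B) := by rw [hB]; ring
          calc (f (K + 1) : ℝ) * (2 * ((1 + T * (C₁ * B + c)) * Real.exp (c * T) *
                (2 * (C₁ * B) * (r : ℝ) ^ (K + 1))) + T * K * (1 - Real.exp (-1)) ^ K)
              ≤ (C₁ * B) * (2 * (((1 + T * C₁ + T * c) * B) * Real.exp (c * T) *
                (2 * (C₁ * B) * ρ ^ K)) + T * (B * B) * ρ ^ K) := by gcongr
            _ = _ := by
                rw [hB9, hC]
                ring
  have hsum : Summable fun K : ℕ => C * (((K + 1 : ℕ) + 1 : ℝ) ^ 9 * ρ ^ (K + 1)) := by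
    have h2 : Summable fun K : ℕ => (K : ℝ) ^ 9 * ρ ^ K :=
      summable_pow_mul_geometric_of_norm_lt_one 9 (by rwa [Real.norm_of_nonneg hρ0.le])
    have h3 := ((summable_nat_add_iff 2).2 h2).mul_left (C * ρ⁻¹)
    refine h3.congr fun K => ?_
    push_cast
    field_simp
    ring
  have hfin : ∑' K : ℕ, Q (⋃ L ∈ Finset.Ico (f (K + 1)) (f (K + 1 + 1)), F L) ≠ ∞ := by
    refine ne_top_of_le_ne_top ?_ (ENNReal.tsum_le_tsum fun K => hbound (K + 1) (Nat.succ_pos K))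
    exact hsum.tsum_ofReal_ne_top
  filter_upwards [ae_eventually_notMem hfin] with z hz
  obtain ⟨K₀, hK₀⟩ := eventually_atTop.1 hz
  refine ⟨f (K₀ + 1), fun L hL s hs => ?_⟩
  by_contra hne
  have hmono : Monotone f := fun i j hij => by
    simp only [hf]
    gcongr
  have hex : ∃ K, L < f K := ⟨L + 1, by
    simp only [hf]
    calc L < L + 1 := Nat.lt_succ_self L
      _ ≤ (L + 1) ^ 3 := Nat.le_self_pow (by norm_num) _
      _ ≤ T * (L + 1) ^ 3 := Nat.le_mul_of_pos_left _ hT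
      _ ≤ _ := Nat.le_add_right _ _⟩
  classical
  set K := Nat.find hex with hKdef
  have hK1 : L < f K := Nat.find_spec hex
  have hK2 : K₀ + 1 < K := by
    by_contra hc
    have := hmono (not_lt.1 hc)
    omega
  have hK3 : f (K - 1) ≤ L := not_lt.1 (Nat.find_min hex (by omega))
  refine hK₀ (K - 2) (by omega) ?_
  refine Set.mem_biUnion (Finset.mem_coe.2 (Finset.mem_Ico.2 ⟨?_, ?_⟩)) (⟨s, hs, hne⟩ : z ∈ F L)
  · rwa [show K - 2 + 1 = K - 1 by omega]
  · rwa [show K - 2 + 1 + 1 = K by omega]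

/-- Almost surely, the cells of a sufficiently fine dyadic grid contain at most one arrival. -/
lemma IsNoise.ae_eventually_simpleCell (h : IsNoise N U P) (a b : ℤ) (T : ℕ) :
    ∀ᵐ ω ∂P, ∀ᶠ j in atTop, ∀ k < T * 2 ^ j, SimpleCell (fun x r => N x r ω) a b
      (gridTime (2 ^ j) k) (gridTime (2 ^ j) (k + 1)) := by
  have hsum : Summable fun j : ℕ => (T : ℝ) * (Finset.Icc a b).card ^ 2 * (1 / 2) ^ j :=
    (summable_geometric_of_lt_one (by norm_num) (by norm_num)).mul_left _
  have hfin : ∑' j : ℕ, P {ω | ∃ k < T * 2 ^ j, ¬ SimpleCell (fun x r => N x r ω) a b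
      (gridTime (2 ^ j) k) (gridTime (2 ^ j) (k + 1))} ≠ ∞ := by
    refine ne_top_of_le_ne_top hsum.tsum_ofReal_ne_top (ENNReal.tsum_le_tsum fun j => ?_)
    refine (h.measure_exists_not_simpleCell_le a b (2 ^ j) (T * 2 ^ j)).trans (le_of_eq ?_)
    congr 1
    push_cast
    rw [one_div_pow 2 j]
    field_simp
  filter_upwards [ae_eventually_notMem hfin] with ω hω
  filter_upwards [hω] with j hj k hk
  by_contra hc
  exact hj ⟨k, hk, hc⟩

end Limit

/-! ### Regularity of the paths -/

section Paths

variable {n : ℤ → ℝ≥0 → ℕ} {lam : ℝ} {u : ℤ × ℕ → ℝ} {σ₀ : Config}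

lemma windowState_eventually_right (hn : GoodPaths n) (L : ℕ) (R : ℤ) (s : ℝ≥0) :
    ∀ᶠ v in 𝓝[≥] s, windowState lam n u σ₀ L R v = windowState lam n u σ₀ L R s := by
  have h1 : ∀ᶠ v in 𝓝[≥] s, ∀ x ∈ Finset.Icc (-(L : ℤ)) R, n x v = n x s := by
    rw [Filter.eventually_all_finset]
    intro x _
    exact hn.rightCont x s ((isOpen_discrete {n x s}).mem_nhds rfl)
  filter_upwards [h1, self_mem_nhdsWithin] with v hv hsv
  exact windowState_of_forall_eq hn hsv hv

/-- A monotone counting path is constant on a left neighbourhood of each time. -/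
lemma exists_eventually_left {m : ℝ≥0 → ℕ} (hm : Monotone m) (s : ℝ≥0) :
    ∃ c, ∀ᶠ v in 𝓝[<] s, m v = c := by
  rcases eq_zero_or_pos s with rfl | hs
  · exact ⟨0, by simp⟩
  · have hfin : (m '' Set.Iio s).Finite := (Set.finite_Iic (m s)).subset (by
      rintro _ ⟨v, hv, rfl⟩
      exact hm (le_of_lt hv))
    obtain ⟨_, ⟨r, hr, rfl⟩, hmax⟩ := Set.exists_max_image _ id hfin ⟨m 0, 0, hs, rfl⟩
    refine ⟨m r, ?_⟩
    filter_upwards [Ioo_mem_nhdsLT hr] with v hv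
    exact le_antisymm (hmax _ ⟨v, hv.2, rfl⟩) (hm hv.1.le)

lemma windowState_eventually_left (hn : GoodPaths n) (L : ℕ) (R : ℤ) (s : ℝ≥0) :
    ∃ η, ∀ᶠ v in 𝓝[<] s, windowState lam n u σ₀ L R v = η := by
  rcases eq_zero_or_pos s with rfl | hs
  · exact ⟨σ₀, by simp⟩
  · choose c hc using fun x => exists_eventually_left (hn.mono x) s
    have h1 : ∀ᶠ v in 𝓝[<] s, ∀ x ∈ Finset.Icc (-(L : ℤ)) R, n x v = c x := by
      rw [Filter.eventually_all_finset]
      exact fun x _ => hc x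
    have : (𝓝[<] s).NeBot := nhdsLT_neBot_of_exists_lt ⟨0, hs⟩
    obtain ⟨r, hr⟩ := h1.exists
    refine ⟨windowState lam n u σ₀ L R r, ?_⟩
    filter_upwards [h1] with v hv
    rcases le_total v r with hvr | hvr
    · exact (windowState_of_forall_eq hn hvr fun x hx => by rw [hv x hx, hr x hx]).symm
    · exact windowState_of_forall_eq hn hvr fun x hx => by rw [hv x hx, hr x hx]

/-- A path in `Config` is càdlàg if its coordinates are locally constant on both sides. -/
lemma isCadlagOn_of_eventually_eq {T : ℝ≥0} {f : ℝ≥0 → Config}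
    (h1 : ∀ s < T, ∀ x, ∀ᶠ v in 𝓝[≥] s, f v x = f s x)
    (h2 : ∀ s < T, ∀ x, ∃ b, ∀ᶠ v in 𝓝[<] s, f v x = b) : IsCadlagOn T f := by
  intro s hs
  constructor
  · refine continuousWithinAt_pi.2 fun x => ?_
    exact tendsto_const_nhds.congr' ((h1 s hs x).mono fun v hv => hv.symm)
  · choose l hl using h2 s hs
    refine ⟨l, tendsto_pi_nhds.2 fun x => ?_⟩
    exact tendsto_const_nhds.congr' ((hl x).mono fun v hv => hv.symm)

lemma cutoff_eventually_right (hn : GoodPaths n) (L : ℕ) (s : ℝ≥0) (x : ℤ) :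
    ∀ᶠ v in 𝓝[≥] s, cutoff lam n u σ₀ L v x = cutoff lam n u σ₀ L s x :=
  (windowState_eventually_right hn L x s).mono fun _ hv => congrFun hv x

lemma cutoff_eventually_left (hn : GoodPaths n) (L : ℕ) (s : ℝ≥0) (x : ℤ) :
    ∃ b, ∀ᶠ v in 𝓝[<] s, cutoff lam n u σ₀ L v x = b := by
  obtain ⟨η, hη⟩ := windowState_eventually_left (lam := lam) (u := u) (σ₀ := σ₀) hn L x s
  exact ⟨η x, hη.mono fun _ hv => congrFun hv x⟩

lemma isCadlagOn_cutoff (hn : GoodPaths n) (L : ℕ) (T : ℝ≥0) :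
    IsCadlagOn T (cutoff lam n u σ₀ L) :=
  isCadlagOn_of_eventually_eq (fun s _ x => cutoff_eventually_right hn L s x)
    fun s _ x => cutoff_eventually_left hn L s x

/-- Paths that coincide eventually at each site converge in the Skorokhod space, with the trivial
time changes. -/
lemma tendstoSkorokhod_of_eventually_eq {T : ℝ≥0} {F : ℕ → ℝ≥0 → Config} {f : ℝ≥0 → Config}
    (hF : ∀ L, IsCadlagOn T (F L)) (hf : IsCadlagOn T f)
    (h : ∀ x, ∀ᶠ L in atTop, ∀ s < T, F L s x = f s x) : TendstoSkorokhod T F f := by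
  refine ⟨hF, hf, fun _ => OrderIso.refl _, fun S => ⟨?_, ?_⟩⟩
  · intro V hV
    exact Eventually.of_forall fun L s _ => refl_mem_uniformity hV
  · rw [tendstoUniformlyOn_iff_tendsto, Pi.uniformity, tendsto_iInf]
    intro x
    rw [tendsto_comap_iff]
    have hu : TendstoUniformlyOn (fun L (s : Set.Iio T) => F L s x) (fun s => f s x) atTop
        (Set.Iic S) := by
      intro V hV
      filter_upwards [h x] with L hL s _
      rw [hL s s.2]
      exact refl_mem_uniformity hV
    exact tendstoUniformlyOn_iff_tendsto.1 hu

end Paths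

/-! ### Measurable approximation -/

section Approximation

/-- The action of the possible arrival at `x` in the time interval `(s, t]`, as seen at time `t`. -/
noncomputable def siteUpdate (lam : ℝ) (n : ℤ → ℝ≥0 → ℕ) (u : ℤ × ℕ → ℝ) (s t : ℝ≥0)
    (η : Config) (x : ℤ) : Config :=
  if n x s < n x t then update lam η x (u (x, n x t)) else η

/-- The dynamics observed only at the times of the grid of mesh `1 / m`: in each cell, the sites of
`[a, b]` are updated once, in increasing order, provided that they have had an arrival. -/
noncomputable def gridState (lam : ℝ) (n : ℤ → ℝ≥0 → ℕ) (u : ℤ × ℕ → ℝ) (σ₀ : Config)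
    (a b : ℤ) (m : ℕ) : ℕ → Config
  | 0 => σ₀
  | k + 1 => ((Finset.Icc a b).sort (· ≤ ·)).foldl
      (siteUpdate lam n u (gridTime m k) (gridTime m (k + 1))) (gridState lam n u σ₀ a b m k)

lemma foldl_eq_self {α β : Type*} (f : β → α → β) (l : List α) (b : β)
    (h : ∀ a ∈ l, ∀ b, f b a = b) : l.foldl f b = b := by
  induction l generalizing b with
  | nil => rfl
  | cons a l ih =>
    rw [List.foldl_cons, h a (by simp)]
    exact ih b fun c hc => h c (by simp [hc])

lemma foldl_eq_single {α β : Type*} (f : β → α → β) (l : List α) (hl : l.Nodup) (b : β) {w : α}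
    (hw : w ∈ l) (h : ∀ a ∈ l, a ≠ w → ∀ b, f b a = b) : l.foldl f b = f b w := by
  induction l generalizing b with
  | nil => simp at hw
  | cons a l ih =>
    rw [List.foldl_cons]
    rw [List.nodup_cons] at hl
    rcases eq_or_ne a w with rfl | haw
    · exact foldl_eq_self f l _ fun c hc => h c (by simp [hc]) fun he => hl.1 (he ▸ hc)
    · rw [h a (by simp) haw]
      refine ih hl.2 b ?_ fun c hc => h c (by simp [hc])
      rcases List.mem_cons.1 hw with he | he
      · exact absurd he.symm haw
      · exact he

lemma gridState_eq_windowState {n : ℤ → ℝ≥0 → ℕ} (hn : GoodPaths n) {lam : ℝ} {u : ℤ × ℕ → ℝ}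
    {σ₀ : Config} {L : ℕ} {R : ℤ} {m M : ℕ}
    (hs : ∀ k < M, SimpleCell n (-(L : ℤ)) R (gridTime m k) (gridTime m (k + 1))) {k : ℕ}
    (hk : k ≤ M) :
    gridState lam n u σ₀ (-(L : ℤ)) R m k = windowState lam n u σ₀ L R (gridTime m k) := by
  induction k with
  | zero =>
    have : gridTime m 0 = 0 := by simp [gridTime]
    rw [this, windowState_zero, gridState]
  | succ k ih =>
    rw [gridState, ih (by omega)]
    rcases hs k (by omega) with h | ⟨x, hx, h1, h2⟩
    · rw [windowState_of_forall_eq hn (gridTime_mono m (Nat.le_succ k)) h]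
      refine foldl_eq_self _ _ _ fun y hy η => ?_
      rw [siteUpdate, h y (by simpa using hy), if_neg (lt_irrefl _)]
    · rw [windowState_of_jump hn hx h1 h2, foldl_eq_single _ _ (Finset.sort_nodup _ _) _
        (by simpa using hx) fun y hy hyx η => ?_]
      · rw [siteUpdate, if_pos (by omega)]
      · rw [siteUpdate, h2 y (by simpa using hy) hyx, if_neg (lt_irrefl _)]

lemma measurable_exchange (x : ℤ) : Measurable fun η : Config => exchange η x := by
  have hF : ∀ z, MeasurableSet {η : Config | FirstOpp η x z} := by
    intro z
    have hne : ∀ y : ℤ, MeasurableSet {η : Config | η y = η x} := fun y =>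
      measurableSet_eq_fun (measurable_pi_apply y) (measurable_pi_apply x)
    have : {η : Config | FirstOpp η x z} = {_η : Config | x < z} ∩ ({η : Config | η z = η x}ᶜ ∩
        ⋂ k : ℤ, ⋂ _ : x < k, ⋂ _ : k < z, {η : Config | η k = η x}) := by
      ext η
      simp [FirstOpp]
    rw [this]
    exact (MeasurableSet.const _).inter ((hne z).compl.inter
      (MeasurableSet.iInter fun k => MeasurableSet.iInter fun _ => MeasurableSet.iInter fun _ =>
        hne k))
  have hv : ∀ y : ℤ, MeasurableSet {η : Config | η y = true} := fun y =>
    (measurable_pi_apply y : Measurable fun η : Config => η y) (measurableSet_singleton true)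
  refine measurable_pi_iff.2 fun y => measurable_to_bool ?_
  have : (fun η : Config => exchange η x y) ⁻¹' {true} =
      (⋃ z, {η : Config | FirstOpp η x z} ∩ {η : Config | η (Equiv.swap x z y) = true}) ∪
      ((⋃ z, {η : Config | FirstOpp η x z})ᶜ ∩ {η : Config | η y = true}) := by
    ext η
    simp only [Set.mem_preimage, Set.mem_singleton_iff, Set.mem_union, Set.mem_iUnion,
      Set.mem_inter_iff, Set.mem_ofPred_eq, Set.mem_compl_iff]
    by_cases hex : ∃ z, FirstOpp η x z
    · obtain ⟨z, hz⟩ := hex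
      rw [exchange_of_firstOpp hz]
      constructor
      · exact fun hy => Or.inl ⟨z, hz, hy⟩
      · rintro (⟨w, hw, hy⟩ | ⟨hc, -⟩)
        · rwa [hz.unique hw]
        · exact absurd ⟨z, hz⟩ hc
    · rw [exchange_of_not_exists hex]
      constructor
      · exact fun hy => Or.inr ⟨hex, hy⟩
      · rintro (⟨w, hw, -⟩ | ⟨-, hy⟩)
        · exact absurd ⟨w, hw⟩ hex
        · exact hy
  rw [this]
  exact (MeasurableSet.iUnion fun z => (hF z).inter (hv _)).union
    ((MeasurableSet.iUnion hF).compl.inter (hv y))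

lemma measurable_update_comp {Z : Type*} [MeasurableSpace Z] (lam : ℝ) (x : ℤ) {η : Z → Config}
    {v : Z → ℝ} (hη : Measurable η) (hv : Measurable v) :
    Measurable fun z => update lam (η z) x (v z) := by
  unfold update
  refine Measurable.ite ?_ ((measurable_exchange x).comp hη) hη
  have hx : Measurable fun z => η z x := (measurable_pi_apply x).comp hη
  exact ((hx (measurableSet_singleton true)).inter (measurableSet_lt hv measurable_const)).union
    ((hx (measurableSet_singleton false)).inter (measurableSet_lt measurable_const hv))

variable {Ω : Type*} [MeasurableSpace Ω] {P : Measure Ω} {N : ℤ → ℝ≥0 → Ω → ℕ}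
  {U : ℤ × ℕ → Ω → ℝ}

lemma IsNoise.measurable_siteUpdate (h : IsNoise N U P) (lam : ℝ) (s t : ℝ≥0) (x : ℤ)
    {g : Config × Ω → Config} (hg : Measurable g) :
    Measurable fun z : Config × Ω =>
      siteUpdate lam (fun x r => N x r z.2) (fun i => U i z.2) s t (g z) x := by
  have hN : ∀ t, Measurable fun z : Config × Ω => N x t z.2 := fun t =>
    ((h.poisson x).measurable t).comp measurable_snd
  have hU : Measurable fun z : Config × Ω => U (x, N x t z.2) z.2 := by
    have h1 : Measurable fun q : ℕ × Ω => U (x, q.1) q.2 :=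
      measurable_from_prod_countable_right fun i => h.measurable_U (x, i)
    exact h1.comp ((hN _).prodMk measurable_snd)
  unfold siteUpdate
  exact Measurable.ite (measurableSet_lt (hN _) (hN _)) (measurable_update_comp lam x hg hU) hg

lemma IsNoise.measurable_gridState (h : IsNoise N U P) (lam : ℝ) (a b : ℤ) (m k : ℕ) :
    Measurable fun z : Config × Ω =>
      gridState lam (fun x r => N x r z.2) (fun i => U i z.2) z.1 a b m k := by
  have hfold : ∀ (l : List ℤ) (s t : ℝ≥0) (g : Config × Ω → Config), Measurable g →
      Measurable fun z : Config × Ω =>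
        l.foldl (siteUpdate lam (fun x r => N x r z.2) (fun i => U i z.2) s t) (g z) := by
    intro l s t
    induction l with
    | nil => exact fun g hg => hg
    | cons x l ih => exact fun g hg => ih _ (h.measurable_siteUpdate lam s t x hg)
  induction k with
  | zero => exact measurable_fst
  | succ k ih => exact hfold _ _ _ _ ih

lemma measurableSet_eventually {Z : Type*} [MeasurableSpace Z] {q : ℕ → Z → Prop}
    (h : ∀ i, MeasurableSet {z | q i z}) : MeasurableSet {z | ∀ᶠ i in atTop, q i z} := by
  have : {z | ∀ᶠ i in atTop, q i z} = ⋃ a, ⋂ i, ⋂ _ : a ≤ i, {z | q i z} := by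
    ext z
    simp [eventually_atTop]
  rw [this]
  exact MeasurableSet.iUnion fun a => MeasurableSet.iInter fun i => MeasurableSet.iInter fun _ => h i

/-- The cut-off dynamics is the limit of the grid dynamics along dyadic grids. -/
lemma eventually_gridState_eq_cutoff {n : ℤ → ℝ≥0 → ℕ} (hn : GoodPaths n) {lam : ℝ}
    {u : ℤ × ℕ → ℝ} {σ₀ : Config} {L : ℕ} {x : ℤ} {s : ℝ≥0} {T : ℕ} (hT : s < T)
    (hs : ∀ᶠ j in atTop, ∀ k < T * 2 ^ j, SimpleCell n (-(L : ℤ)) x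
      (gridTime (2 ^ j) k) (gridTime (2 ^ j) (k + 1))) :
    ∀ᶠ j : ℕ in atTop, gridState lam n u σ₀ (-(L : ℤ)) x (2 ^ j) ⌈s * 2 ^ j⌉₊ x =
      cutoff lam n u σ₀ L s x := by
  have hle : ∀ j : ℕ, s ≤ gridTime (2 ^ j) ⌈s * 2 ^ j⌉₊ := by
    intro j
    unfold gridTime
    rw [le_div_iff₀ (by positivity)]
    push_cast
    exact Nat.le_ceil _
  have hlim : Tendsto (fun j : ℕ => gridTime (2 ^ j) ⌈s * 2 ^ j⌉₊) atTop (𝓝[≥] s) := by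
    refine tendsto_nhdsWithin_iff.2 ⟨?_, Eventually.of_forall hle⟩
    have h1 : Tendsto (fun j : ℕ => s + (1 / 2 : ℝ≥0) ^ j) atTop (𝓝 (s + 0)) :=
      tendsto_const_nhds.add (NNReal.tendsto_pow_atTop_nhds_zero_of_lt_one (by
        rw [← NNReal.coe_lt_coe]; norm_num))
    rw [add_zero] at h1
    refine tendsto_of_tendsto_of_tendsto_of_le_of_le tendsto_const_nhds h1 hle fun j => ?_
    show gridTime (2 ^ j) ⌈s * 2 ^ j⌉₊ ≤ s + (1 / 2) ^ j
    unfold gridTime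
    rw [div_le_iff₀ (by positivity), add_mul]
    push_cast
    have : (1 / 2 : ℝ≥0) ^ j * 2 ^ j = 1 := by rw [← mul_pow]; simp
    rw [this]
    exact (Nat.ceil_lt_add_one (by positivity)).le
  filter_upwards [hlim.eventually (windowState_eventually_right (lam := lam) (u := u) (σ₀ := σ₀)
    hn L x s), hs] with j hj1 hj2
  rw [gridState_eq_windowState hn hj2, hj1, cutoff]
  rw [Nat.ceil_le]
  push_cast
  gcongr

end Approximation

/-! ### The limit process -/

section LimitProcess

variable {Ω : Type*} {N : ℤ → ℝ≥0 → Ω → ℕ} {U : ℤ × ℕ → Ω → ℝ}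

/-- The realizations for which the cut-off dynamics have a limit: the counting paths are regular,
the cells of fine dyadic grids contain at most one arrival, and the cut-off paths stabilize. -/
structure GoodRealization (N : ℤ → ℝ≥0 → Ω → ℕ) (U : ℤ × ℕ → Ω → ℝ) (lam : ℝ)
    (z : Config × Ω) : Prop where
  paths : GoodPaths fun x r => N x r z.2
  simple : ∀ (a b : ℤ) (T : ℕ), ∀ᶠ j in atTop, ∀ k < T * 2 ^ j,
    SimpleCell (fun x r => N x r z.2) a b (gridTime (2 ^ j) k) (gridTime (2 ^ j) (k + 1))
  stable : ∀ (x : ℤ) (T : ℕ), 0 < T → ∃ L₀ : ℕ, ∀ L, L₀ ≤ L → ∀ s < (T : ℝ≥0),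
    cutoff lam (fun x r => N x r z.2) (fun i => U i z.2) z.1 L s x =
      cutoff lam (fun x r => N x r z.2) (fun i => U i z.2) z.1 (L + 1) s x

open Classical in
/-- The limit of the cut-off dynamics on the set `G` of realizations, and a constant path outside
of `G`. -/
noncomputable def limitProcess (N : ℤ → ℝ≥0 → Ω → ℕ) (U : ℤ × ℕ → Ω → ℝ) (lam : ℝ)
    (G : Set (Config × Ω)) (z : Config × Ω) (s : ℝ≥0) : Config := fun x =>
  decide (z ∈ G ∧ ∀ᶠ L : ℕ in atTop,
    cutoff lam (fun x r => N x r z.2) (fun i => U i z.2) z.1 L s x = true)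

lemma limitProcess_eq_true_iff {lam : ℝ} {G : Set (Config × Ω)} {z : Config × Ω} {s : ℝ≥0}
    {x : ℤ} : limitProcess N U lam G z s x = true ↔ z ∈ G ∧ ∀ᶠ L : ℕ in atTop,
      cutoff lam (fun x r => N x r z.2) (fun i => U i z.2) z.1 L s x = true := by
  simp [limitProcess]

/-- The limit process coincides at each site with the cut-off dynamics for large cut-offs. -/
lemma GoodRealization.exists_cutoff_eq {lam : ℝ} {G : Set (Config × Ω)} {z : Config × Ω}
    (hz : GoodRealization N U lam z) (hzG : z ∈ G) (x : ℤ) (T : ℕ) :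
    ∃ L₀ : ℕ, ∀ L, L₀ ≤ L → ∀ s < (T : ℝ≥0),
      cutoff lam (fun x r => N x r z.2) (fun i => U i z.2) z.1 L s x =
        limitProcess N U lam G z s x := by
  rcases Nat.eq_zero_or_pos T with rfl | hT
  · exact ⟨0, fun L _ s hs => absurd hs (by simp)⟩
  obtain ⟨L₀, hL₀⟩ := hz.stable x T hT
  have hconst : ∀ L, L₀ ≤ L → ∀ s < (T : ℝ≥0),
      cutoff lam (fun x r => N x r z.2) (fun i => U i z.2) z.1 L s x =
        cutoff lam (fun x r => N x r z.2) (fun i => U i z.2) z.1 L₀ s x := by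
    intro L hL s hs
    induction L, hL using Nat.le_induction with
    | base => rfl
    | succ L hL ih => rw [← hL₀ L hL s hs, ih]
  refine ⟨L₀, fun L hL s hs => ?_⟩
  rw [hconst L hL s hs]
  have hiff : (∀ᶠ L : ℕ in atTop,
      cutoff lam (fun x r => N x r z.2) (fun i => U i z.2) z.1 L s x = true) ↔
      cutoff lam (fun x r => N x r z.2) (fun i => U i z.2) z.1 L₀ s x = true := by
    constructor
    · intro hev
      obtain ⟨L₁, hL₁, hL₁'⟩ := (hev.and (eventually_ge_atTop L₀)).exists
      rwa [hconst L₁ hL₁' s hs] at hL₁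
    · intro ht
      filter_upwards [eventually_ge_atTop L₀] with L₁ hL₁
      rwa [hconst L₁ hL₁ s hs]
  rw [Bool.eq_iff_iff, limitProcess_eq_true_iff, hiff]
  exact ⟨fun ht => ⟨hzG, ht⟩, fun ht => ht.2⟩

lemma isCadlagOn_limitProcess {lam : ℝ} {G : Set (Config × Ω)}
    (hG : ∀ z ∈ G, GoodRealization N U lam z) (z : Config × Ω) (t : ℝ≥0) :
    IsCadlagOn t (limitProcess N U lam G z) := by
  by_cases hzG : z ∈ G
  · have hz := hG z hzG
    have key : ∀ (s : ℝ≥0) (x : ℤ), ∃ L, ∀ᶠ v in 𝓝 s, limitProcess N U lam G z v x =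
        cutoff lam (fun x r => N x r z.2) (fun i => U i z.2) z.1 L v x := by
      intro s x
      obtain ⟨T, hT⟩ := exists_nat_gt s
      obtain ⟨L, hL⟩ := hz.exists_cutoff_eq hzG x T
      refine ⟨L, ?_⟩
      filter_upwards [Iio_mem_nhds hT] with v hv
      exact (hL L le_rfl v hv).symm
    refine isCadlagOn_of_eventually_eq (fun s _ x => ?_) fun s _ x => ?_
    · obtain ⟨L, hL⟩ := key s x
      filter_upwards [cutoff_eventually_right hz.paths L s x, hL.filter_mono nhdsWithin_le_nhds]
        with v h1 h2
      rw [h2, h1, hL.self_of_nhds]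
    · obtain ⟨L, hL⟩ := key s x
      obtain ⟨b, hb⟩ := cutoff_eventually_left (lam := lam) (u := fun i => U i z.2) (σ₀ := z.1)
        hz.paths L s x
      refine ⟨b, ?_⟩
      filter_upwards [hb, hL.filter_mono nhdsWithin_le_nhds] with v h1 h2
      rw [h2, h1]
  · have hfalse : ∀ s x, limitProcess N U lam G z s x = false := fun s x => by
      simp [limitProcess, hzG]
    refine isCadlagOn_of_eventually_eq (fun s _ x => ?_) fun s _ x => ⟨false, ?_⟩
    · exact Eventually.of_forall fun v => by rw [hfalse, hfalse]
    · exact Eventually.of_forall fun v => hfalse v x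

variable [MeasurableSpace Ω] {P : Measure Ω}

lemma IsNoise.ae_goodRealization [IsProbabilityMeasure P] (h : IsNoise N U P) {lam : ℝ}
    (h0 : 0 < lam) (h1 : lam < 1) {p : unitInterval} (hp0 : 0 < p) (hp1 : p < 1) :
    ∀ᵐ z ∂((ber p).prod P), GoodRealization N U lam z := by
  have e2 : ∀ᵐ ω ∂P, ∀ (a b : ℤ) (T : ℕ), ∀ᶠ j in atTop, ∀ k < T * 2 ^ j,
      SimpleCell (fun x r => N x r ω) a b (gridTime (2 ^ j) k) (gridTime (2 ^ j) (k + 1)) := by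
    simp only [ae_all_iff]
    exact fun a b T => h.ae_eventually_simpleCell a b T
  have e3 : ∀ᵐ z ∂((ber p).prod P), ∀ (x : ℤ) (T : ℕ), 0 < T → ∃ L₀ : ℕ, ∀ L, L₀ ≤ L →
      ∀ s < (T : ℝ≥0), cutoff lam (fun x r => N x r z.2) (fun i => U i z.2) z.1 L s x =
        cutoff lam (fun x r => N x r z.2) (fun i => U i z.2) z.1 (L + 1) s x := by
    simp only [ae_all_iff]
    exact fun x T hT => h.ae_eventually_cutoff_eq h0 h1 hp0 hp1 x hT
  filter_upwards [ae_prod_of_ae_snd h.ae_goodPaths, ae_prod_of_ae_snd e2, e3] with z a1 a2 a3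
  exact ⟨a1, a2, a3⟩

lemma IsNoise.measurable_limitProcess (h : IsNoise N U P) {lam : ℝ} {G : Set (Config × Ω)}
    (hGm : MeasurableSet G) (hG : ∀ z ∈ G, GoodRealization N U lam z) (t : ℝ≥0) :
    Measurable fun z => limitProcess N U lam G z t := by
  refine measurable_pi_iff.2 fun x => measurable_to_bool ?_
  obtain ⟨T, hT⟩ := exists_nat_gt t
  have e : (fun z => limitProcess N U lam G z t x) ⁻¹' {true} = G ∩
      {z | ∀ᶠ L : ℕ in atTop, ∀ᶠ j : ℕ in atTop, gridState lam (fun x r => N x r z.2)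
        (fun i => U i z.2) z.1 (-(L : ℤ)) x (2 ^ j) ⌈t * 2 ^ j⌉₊ x = true} := by
    ext z
    simp only [Set.mem_preimage, Set.mem_singleton_iff, limitProcess_eq_true_iff,
      Set.mem_inter_iff, Set.mem_ofPred_eq]
    refine and_congr_right fun hzG => ?_
    have hz := hG z hzG
    refine eventually_congr (Eventually.of_forall fun L => ?_)
    have hev := eventually_gridState_eq_cutoff (lam := lam) (u := fun i => U i z.2) (σ₀ := z.1)
      hz.paths hT (hz.simple (-(L : ℤ)) x T)
    constructor
    · intro ht
      filter_upwards [hev] with j hj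
      rw [hj, ht]
    · intro ht
      obtain ⟨j, hj1, hj2⟩ := (hev.and ht).exists
      rw [← hj1, hj2]
  rw [e]
  refine hGm.inter (measurableSet_eventually fun L => measurableSet_eventually fun j => ?_)
  exact ((measurable_pi_apply x).comp (h.measurable_gridState lam (-(L : ℤ)) x (2 ^ j) ⌈t * 2 ^ j⌉₊))
    (measurableSet_singleton true)

end LimitProcess

end ToomInterface

theorem mainTheorem5 {Ω : Type*} [MeasurableSpace Ω] (P : Measure Ω) [IsProbabilityMeasure P]
    (N : ℤ → ℝ≥0 → Ω → ℕ) (U : ℤ × ℕ → Ω → ℝ) (hNU : ToomInterface.IsNoise N U P)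
    (lamPlus lamMinus : ℝ) (hplus : 0 < lamPlus) (hminus : 0 < lamMinus)
    (hsum : lamPlus + lamMinus = 1) (p : unitInterval) (hp0 : 0 < p) (hp1 : p < 1) :
    ∃ σ : ToomInterface.Config × Ω → ℝ≥0 → ToomInterface.Config,
      (∀ t, Measurable fun z => σ z t) ∧
      (∀ z t, ToomInterface.IsCadlagOn t (σ z)) ∧
      ∀ t : ℝ≥0, ∀ᵐ z ∂((ToomInterface.ber p).prod P),
        ToomInterface.TendstoSkorokhod t
          (fun L s => ToomInterface.cutoff lamPlus (fun x r => N x r z.2) (fun i => U i z.2) z.1 L s)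
          (σ z) ∧
        ∀ x : ℤ, ∀ᶠ L : ℕ in atTop, ∀ s < t,
          ToomInterface.cutoff lamPlus (fun x r => N x r z.2) (fun i => U i z.2) z.1 L s x
            = σ z s x := by
  have hgood := hNU.ae_goodRealization hplus (by linarith : lamPlus < 1) hp0 hp1
  -- a measurable set of good realizations of full measure
  set Q := (ToomInterface.ber p).prod P
  set G : Set (ToomInterface.Config × Ω) :=
    (toMeasurable Q {z | ToomInterface.GoodRealization N U lamPlus z}ᶜ)ᶜ
  have hGm : MeasurableSet G := (measurableSet_toMeasurable _ _).compl
  have hG : ∀ z ∈ G, ToomInterface.GoodRealization N U lamPlus z := fun z hz => by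
    by_contra hc
    exact hz (subset_toMeasurable _ _ hc)
  have hae : ∀ᵐ z ∂Q, z ∈ G := by
    rw [ae_iff]
    simp only [G, Set.mem_compl_iff, not_not]
    exact (measure_toMeasurable _).trans hgood
  refine ⟨ToomInterface.limitProcess N U lamPlus G, hNU.measurable_limitProcess hGm hG,
    ToomInterface.isCadlagOn_limitProcess hG, fun t => ?_⟩
  filter_upwards [hae] with z hz
  have hev : ∀ x : ℤ, ∀ᶠ L : ℕ in atTop, ∀ s < t,
      ToomInterface.cutoff lamPlus (fun x r => N x r z.2) (fun i => U i z.2) z.1 L s x =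
        ToomInterface.limitProcess N U lamPlus G z s x := by
    intro x
    obtain ⟨T, hT⟩ := exists_nat_gt t
    obtain ⟨L₀, hL₀⟩ := (hG z hz).exists_cutoff_eq hz x T
    filter_upwards [eventually_ge_atTop L₀] with L hL s hs
    exact hL₀ L hL s (hs.trans hT)
  exact ⟨ToomInterface.tendstoSkorokhod_of_eventually_eq
    (fun L => ToomInterface.isCadlagOn_cutoff (hG z hz).paths L t)
    (ToomInterface.isCadlagOn_limitProcess hG z t) hev, hev⟩
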